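/- Let $K$ be a field, $\mathscr X$ a small category and $\mathcal C:\mathscr X\to Coalg_K$ a functor to $K$-coalgebras such that every $\mathcal C_x$ is cocommutative. Write $\mathbf M^{C}$ for the category of right $C$-comodules and $\mathbf M_{[C,-]}$ for the category of right $C$-contramodules (spaces $M$ with a contraassociative, counital map $\pi_M:Hom_K(C,M)\to M$). For a coalgebra map $\alpha:C\to D$ let $\alpha^*:\mathbf M^C\to\mathbf M^D$ be corestriction, with coaction $(id\otimes\alpha)\rho$, and let $\alpha_\bullet:\mathbf M_{[C,-]}\to\mathbf M_{[D,-]}$ be contrarestriction, with contraaction $f\mapsto\pi(f\circ\alpha)$. A trans-comodule $\mathcal M\in Com^{tr}\text{-}\mathcal C$ consists of $\mathcal M_x\in\mathbf M^{\mathcal C_x}$ and morphisms ${}_\alpha\mathcal M:\mathcal M_y\to\alpha^*\mathcal M_x$ in $\mathbf M^{\mathcal C_y}$ for all $\alpha:x\to y$, with ${}_{id}\mathcal M=id$ and ${}_{\beta\alpha}\mathcal M=\beta^*({}_\alpha\mathcal M)\circ{}_\beta\mathcal M$. A trans-contramodule $\mathcal M\in Cont^{tr}\text{-}\mathcal C$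 is defined in the same way, with $\mathcal M_x\in\mathbf M_{[\mathcal C_x,-]}$ and morphisms ${}_\alpha\mathcal M:\mathcal M_y\to\alpha_\bullet\mathcal M_x$. Morphisms are families of morphisms $(\eta_x)_x$ that commute with the structure maps. A right comodule $M$ over $C$ is quasi-finite if $-\otimes M:Vect\to\mathbf M^C$ has a left adjoint $H_C(M,-)$. The representation $\mathcal C$ is quasi-finite if each $\mathcal C_\alpha:\mathcal C_x\to\mathcal C_y$ makes $\mathcal C_x$ a quasi-finite right $\mathcal C_y$-comodule; then $\alpha^*$ has the left adjoint $\alpha^!=H_{\mathcal C_y}(\mathcal C_x,-)$, and a trans-comodule $\mathcal N$ is cartesian if for every $\alpha:x\to y$ the morphism ${}^\alpha\mathcal N:\alpha^!\mathcal N_y\to\mathcal N_x$ that corresponds to ${}_\alpha\mathcal N$ is an isomorphism. For a cocommutative coalgebra $C$, $M\in\mathbf M_{[C,-]}$ and $N\in\mathbf M^C$, the contratensor product $M\boxtimes_CN\in\mathbf M^C$ is the coequalizer of the two maps $Hom_K(C,M)\otimes N\rightrightarrows M\otimes N$ induced by $\pi_M$ and by $N\to C\otimes N$, with the coaction induced by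 that of $N$. For $N,P\in\mathbf M^C$, the space $\mathbf M^C(N,P)$ is a right $C$-contramodule by $\pi(f)(n)=f(n_{(1)})(n_{(0)})$. Let $\mathcal N$ be a trans-comodule over $\mathcal C$. (a) There is a functor $F:Cont^{tr}\text{-}\mathcal C\to Com^{tr}\text{-}\mathcal C$ with $F(\mathcal M)_x=\mathcal M_x\boxtimes_{\mathcal C_x}\mathcal N_x$ for all $x$, whose structure map at $\alpha:y\to x$ sends the class of $m\otimes n$ to the class of ${}_\alpha\mathcal M(m)\otimes{}_\alpha\mathcal N(n)$, and with $F(\varphi)_x=\varphi_x\boxtimes id$. (b) Suppose that $\mathcal C$ is quasi-finite and that $\mathcal N$ is cartesian. Then there is a functor $G:Com^{tr}\text{-}\mathcal C\to Cont^{tr}\text{-}\mathcal C$ with $G(\mathcal P)_x=\mathbf M^{\mathcal C_x}(\mathcal N_x,\mathcal P_x)$ for all $x$, whose structure map at $\alpha:y\to x$ sends $\varphi:\mathcal N_x\to\mathcal P_x$ to ${}^\alpha\mathcal P\circ\alpha^!(\varphi)\circ({}^\alpha\mathcal N)^{-1}:\mathcal N_y\to\mathcal P_y$, and with $G(\psi)_x=\psi_x\circ-$.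 Moreover, $F$ is left adjoint to $G$. -/

import Mathlib

open CategoryTheory
open scoped TensorProduct

universe u w₁ w₂

/-! ### Right comodules -/

/-- A right comodule over a `K`-coalgebra `C`: a vector space with a coassociative and counital
coaction `ρ : M → M ⊗ C`. -/
structure RightComodule (K : Type u) [Field K] (C : Type u) [AddCommGroup C] [Module K C]
    [Coalgebra K C] where
  carrier : Type u
  [addCommGroup : AddCommGroup carrier]
  [module : Module K carrier]
  coact : carrier →ₗ[K] carrier ⊗[K] C
  coassoc : (TensorProduct.assoc K carrier C C).toLinearMap ∘ₗ coact.rTensor C ∘ₗ coact =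
    (Coalgebra.comul (R := K) (A := C)).lTensor carrier ∘ₗ coact
  rid_counit : (TensorProduct.rid K carrier).toLinearMap ∘ₗ
    (Coalgebra.counit (R := K) (A := C)).lTensor carrier ∘ₗ coact = LinearMap.id

attribute [instance] RightComodule.addCommGroup RightComodule.module

namespace RightComodule

variable {K : Type u} [Field K]
variable {C : Type u} [AddCommGroup C] [Module K C] [Coalgebra K C]
variable {D : Type u} [AddCommGroup D] [Module K D] [Coalgebra K D]

/-- The subspace of `Hom_K(M, N)` formed by the morphisms of right `C`-comodules. -/
def homs (M N : RightComodule K C) : Submodule K (M.carrier →ₗ[K] N.carrier) where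
  carrier := {f | N.coact ∘ₗ f = f.rTensor C ∘ₗ M.coact}
  add_mem' {f g} hf hg := by
    simp only [Set.mem_ofPred_eq] at *
    rw [LinearMap.comp_add, hf, hg, LinearMap.rTensor_add, LinearMap.add_comp]
  zero_mem' := by simp
  smul_mem' c f hf := by
    simp only [Set.mem_ofPred_eq] at *
    rw [LinearMap.comp_smul, hf, LinearMap.rTensor_smul, LinearMap.smul_comp]

/-- A morphism of right comodules: a linear map that commutes with the coactions. -/
@[ext]
structure Hom (M N : RightComodule K C) where
  lin : M.carrier →ₗ[K] N.carrier
  mem : lin ∈ homs M N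

/-- The category `M^C` of right `C`-comodules. -/
instance : Category (RightComodule K C) where
  Hom M N := Hom M N
  id M := ⟨LinearMap.id, by simp [homs]⟩
  comp {M N P} f g := ⟨g.lin ∘ₗ f.lin, by
    have hf : N.coact ∘ₗ f.lin = f.lin.rTensor C ∘ₗ M.coact := f.mem
    have hg : P.coact ∘ₗ g.lin = g.lin.rTensor C ∘ₗ N.coact := g.mem
    change P.coact ∘ₗ (g.lin ∘ₗ f.lin) = (g.lin ∘ₗ f.lin).rTensor C ∘ₗ M.coact
    rw [← LinearMap.comp_assoc, hg, LinearMap.comp_assoc, hf, LinearMap.rTensor_comp,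
      LinearMap.comp_assoc]⟩

/-- The underlying linear map of a morphism of comodules. -/
def linMap {M N : RightComodule K C} (f : M ⟶ N) : M.carrier →ₗ[K] N.carrier := Hom.lin f

@[ext]
theorem hom_ext {M N : RightComodule K C} {f g : M ⟶ N} (h : linMap f = linMap g) : f = g :=
  Hom.ext h

@[simp] theorem linMap_id (M : RightComodule K C) : linMap (𝟙 M) = LinearMap.id := rfl

@[simp] theorem linMap_comp {M N P : RightComodule K C} (f : M ⟶ N) (g : N ⟶ P) :
    linMap (f ≫ g) = linMap g ∘ₗ linMap f := rfl

theorem linMap_comm {M N : RightComodule K C} (f : M ⟶ N) :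
    N.coact ∘ₗ linMap f = (linMap f).rTensor C ∘ₗ M.coact := Hom.mem f

/-- An element of the space `homs M N`, regarded as a morphism of comodules. -/
def ofHoms {M N : RightComodule K C} (f : homs M N) : M ⟶ N := Hom.mk f.1 f.2

variable (K C) in
/-- The coalgebra `C` as a right comodule over itself. -/
def regular : RightComodule K C where
  carrier := C
  coact := Coalgebra.comul
  coassoc := Coalgebra.coassoc
  rid_counit := by
    ext c
    simp

/-- The corestriction `α^* M` of a right `C`-comodule along a morphism `α : C → D` of coalgebras:
the coaction is `(id ⊗ α) ∘ ρ`. -/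
def corestrictObj (α : C →ₗc[K] D) (M : RightComodule K C) : RightComodule K D where
  carrier := M.carrier
  coact := α.toLinearMap.lTensor M.carrier ∘ₗ M.coact
  coassoc := by
    have h1 : (TensorProduct.assoc K M.carrier D D).toLinearMap ∘ₗ
        (α.toLinearMap.lTensor M.carrier ∘ₗ M.coact).rTensor D ∘ₗ
          α.toLinearMap.lTensor M.carrier =
        (TensorProduct.map α.toLinearMap α.toLinearMap).lTensor M.carrier ∘ₗ
          (TensorProduct.assoc K M.carrier C C).toLinearMap ∘ₗ M.coact.rTensor C := by
      ext m c
      simp only [TensorProduct.AlgebraTensorModule.curry_apply, LinearMap.restrictScalars_self,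
        TensorProduct.curry_apply, LinearMap.comp_apply, LinearMap.lTensor_tmul,
        LinearMap.rTensor_tmul, LinearEquiv.coe_coe]
      induction M.coact m using TensorProduct.induction_on with
      | zero => simp
      | tmul a b => simp
      | add a b ha hb => simp only [map_add, TensorProduct.add_tmul, ha, hb]
    have h2 : (TensorProduct.map α.toLinearMap α.toLinearMap) ∘ₗ
        Coalgebra.comul (R := K) (A := C) = Coalgebra.comul ∘ₗ α.toLinearMap :=
      α.map_comp_comul
    ext m
    have e1 := LinearMap.congr_fun h1 (M.coact m)
    have e2 := LinearMap.congr_fun M.coassoc m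
    simp only [LinearMap.comp_apply] at e1 e2 ⊢
    rw [e1, e2, ← LinearMap.lTensor_comp_apply, h2, LinearMap.lTensor_comp_apply]
  rid_counit := by
    have h : Coalgebra.counit (R := K) (A := D) ∘ₗ α.toLinearMap = Coalgebra.counit :=
      α.counit_comp
    ext m
    have e := LinearMap.congr_fun M.rid_counit m
    simp only [LinearMap.comp_apply] at e ⊢
    rw [← LinearMap.lTensor_comp_apply, h, e]

/-- The corestriction functor `α^* : M^C ⥤ M^D` along a morphism `α : C → D` of coalgebras. -/
def corestrict (α : C →ₗc[K] D) : RightComodule K C ⥤ RightComodule K D where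
  obj M := corestrictObj α M
  map {M N} f := Hom.mk (M := corestrictObj α M) (N := corestrictObj α N) (linMap f :) (by
    change (α.toLinearMap.lTensor N.carrier ∘ₗ N.coact) ∘ₗ linMap f =
      (linMap f).rTensor D ∘ₗ (α.toLinearMap.lTensor M.carrier ∘ₗ M.coact)
    rw [LinearMap.comp_assoc, linMap_comm, ← LinearMap.comp_assoc, ← LinearMap.comp_assoc,
      LinearMap.lTensor_comp_rTensor, LinearMap.rTensor_comp_lTensor])

/-- The comodule `V ⊗ M`, on which `C` coacts through `M`. -/
def tensorObj (V : Type u) [AddCommGroup V] [Module K V] (M : RightComodule K C) :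
    RightComodule K C where
  carrier := V ⊗[K] M.carrier
  coact := (TensorProduct.assoc K V M.carrier C).symm.toLinearMap ∘ₗ M.coact.lTensor V
  coassoc := by
    ext v m
    have e := LinearMap.congr_fun M.coassoc m
    simp only [TensorProduct.AlgebraTensorModule.curry_apply, LinearMap.restrictScalars_self,
      TensorProduct.curry_apply, LinearMap.comp_apply, LinearMap.lTensor_tmul,
      LinearEquiv.coe_coe] at e ⊢
    have h1 : ∀ t : M.carrier ⊗[K] C,
        TensorProduct.assoc K (V ⊗[K] M.carrier) C C
          ((((TensorProduct.assoc K V M.carrier C).symm.toLinearMap ∘ₗ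
            M.coact.lTensor V).rTensor C) ((TensorProduct.assoc K V M.carrier C).symm (v ⊗ₜ t))) =
        (TensorProduct.assoc K V M.carrier (C ⊗[K] C)).symm
          (v ⊗ₜ TensorProduct.assoc K M.carrier C C (M.coact.rTensor C t)) := by
      intro t
      induction t using TensorProduct.induction_on with
      | zero => simp
      | add a b ha hb => simp only [map_add, TensorProduct.tmul_add, ha, hb]
      | tmul n c =>
        simp only [TensorProduct.assoc_symm_tmul, LinearMap.rTensor_tmul, LinearMap.comp_apply,
          LinearMap.lTensor_tmul, LinearEquiv.coe_coe]
        induction M.coact n using TensorProduct.induction_on with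
        | zero => simp
        | add a b ha hb => simp only [map_add, TensorProduct.add_tmul, TensorProduct.tmul_add, ha, hb]
        | tmul n c => simp
    have h2 : ∀ t : M.carrier ⊗[K] C,
        (Coalgebra.comul (R := K) (A := C)).lTensor (V ⊗[K] M.carrier)
          ((TensorProduct.assoc K V M.carrier C).symm (v ⊗ₜ t)) =
        (TensorProduct.assoc K V M.carrier (C ⊗[K] C)).symm
          (v ⊗ₜ (Coalgebra.comul (R := K) (A := C)).lTensor M.carrier t) := by
      intro t
      induction t using TensorProduct.induction_on with
      | zero => simp
      | add a b ha hb => simp only [map_add, TensorProduct.tmul_add, ha, hb]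
      | tmul n c => simp
    rw [h1, h2, e]
  rid_counit := by
    ext v m
    have e := LinearMap.congr_fun M.rid_counit m
    simp only [TensorProduct.AlgebraTensorModule.curry_apply, LinearMap.restrictScalars_self,
      TensorProduct.curry_apply, LinearMap.comp_apply, LinearMap.lTensor_tmul,
      LinearEquiv.coe_coe, LinearMap.id_apply] at e ⊢
    have h : ∀ t : M.carrier ⊗[K] C,
        TensorProduct.rid K (V ⊗[K] M.carrier)
          ((Coalgebra.counit (R := K) (A := C)).lTensor (V ⊗[K] M.carrier)
            ((TensorProduct.assoc K V M.carrier C).symm (v ⊗ₜ t))) =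
        v ⊗ₜ TensorProduct.rid K M.carrier
          ((Coalgebra.counit (R := K) (A := C)).lTensor M.carrier t) := by
      intro t
      induction t using TensorProduct.induction_on with
      | zero => simp
      | add a b ha hb => simp only [map_add, TensorProduct.tmul_add, ha, hb]
      | tmul n c => simp
    rw [h, e]

/-- The functor `- ⊗ M : Vect ⥤ M^C`. -/
def tensorFunctor (M : RightComodule K C) : ModuleCat.{u} K ⥤ RightComodule K C where
  obj V := tensorObj V M
  map {V W} f := Hom.mk (M := tensorObj V M) (N := tensorObj W M) (f.hom.rTensor M.carrier) (by
    change ((TensorProduct.assoc K W M.carrier C).symm.toLinearMap ∘ₗ M.coact.lTensor W) ∘ₗ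
        f.hom.rTensor M.carrier = (f.hom.rTensor M.carrier).rTensor C ∘ₗ
        ((TensorProduct.assoc K V M.carrier C).symm.toLinearMap ∘ₗ M.coact.lTensor V)
    ext v m
    simp only [TensorProduct.AlgebraTensorModule.curry_apply, LinearMap.restrictScalars_self,
      TensorProduct.curry_apply, LinearMap.comp_apply, LinearMap.lTensor_tmul,
      LinearMap.rTensor_tmul, LinearEquiv.coe_coe]
    induction M.coact m using TensorProduct.induction_on with
    | zero => simp
    | add a b ha hb => simp only [map_add, TensorProduct.tmul_add, ha, hb]
    | tmul n c => simp)
  map_id V := by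
    apply hom_ext
    change (LinearMap.id : V →ₗ[K] V).rTensor M.carrier = LinearMap.id
    simp
  map_comp f g := by
    apply hom_ext
    change (g.hom ∘ₗ f.hom).rTensor M.carrier = g.hom.rTensor _ ∘ₗ f.hom.rTensor _
    rw [LinearMap.rTensor_comp]

/-- A right comodule `M` is quasi-finite if the functor `- ⊗ M : Vect ⥤ M^C` has a left adjoint. -/
class IsQuasiFinite (M : RightComodule K C) : Prop where
  isRightAdjoint : (tensorFunctor M).IsRightAdjoint

attribute [instance] IsQuasiFinite.isRightAdjoint

/-- The functor `H_C(M, -) : M^C ⥤ Vect` of a quasi-finite comodule `M`, which is left adjoint to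
`- ⊗ M`. -/
noncomputable def cohom (M : RightComodule K C) [IsQuasiFinite M] :
    RightComodule K C ⥤ ModuleCat.{u} K := (tensorFunctor M).leftAdjoint

/-- The adjunction between `H_C(M, -)` and `- ⊗ M`. -/
noncomputable def cohomAdj (M : RightComodule K C) [IsQuasiFinite M] :
    cohom M ⊣ tensorFunctor M := Adjunction.ofIsRightAdjoint _

/-- The unit `M → H_C(N, M) ⊗ N` of the adjunction, as a linear map. -/
noncomputable def cohomUnit (N : RightComodule K C) [IsQuasiFinite N] (M : RightComodule K C) :
    M.carrier →ₗ[K] (cohom N).obj M ⊗[K] N.carrier :=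
  linMap ((cohomAdj N).unit.app M)

/-- The linear map `H_C(N, M) → V` that corresponds to a morphism `M → V ⊗ N` of comodules. -/
noncomputable def cohomDesc {N : RightComodule K C} [IsQuasiFinite N] {M : RightComodule K C}
    {V : Type u} [AddCommGroup V] [Module K V] (k : M ⟶ tensorObj V N) :
    (cohom N).obj M →ₗ[K] V :=
  (((cohomAdj N).homEquiv M (ModuleCat.of K V)).symm k).hom

theorem cohomDesc_unit {N : RightComodule K C} [IsQuasiFinite N] {M : RightComodule K C}
    {V : Type u} [AddCommGroup V] [Module K V] (k : M ⟶ tensorObj V N) :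
    (cohomDesc k).rTensor N.carrier ∘ₗ cohomUnit N M = linMap k := by
  have h := ((cohomAdj N).homEquiv M (ModuleCat.of K V)).apply_symm_apply k
  rw [Adjunction.homEquiv_unit] at h
  exact congrArg linMap h

theorem cohom_hom_ext {N : RightComodule K C} [IsQuasiFinite N] {M : RightComodule K C}
    {V : Type u} [AddCommGroup V] [Module K V] {f g : (cohom N).obj M →ₗ[K] V}
    (h : f.rTensor N.carrier ∘ₗ cohomUnit N M = g.rTensor N.carrier ∘ₗ cohomUnit N M) :
    f = g := by
  have : ModuleCat.ofHom f = ModuleCat.ofHom g := by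
    apply ((cohomAdj N).homEquiv M (ModuleCat.of K V)).injective
    rw [Adjunction.homEquiv_unit, Adjunction.homEquiv_unit]
    apply hom_ext
    exact h
  exact congrArg ModuleCat.Hom.hom this

/-- A morphism of coalgebras `α : C → D` is quasi-finite if it makes `C` a quasi-finite right
`D`-comodule. -/
abbrev IsQuasiFiniteHom (α : C →ₗc[K] D) : Prop := IsQuasiFinite (corestrictObj α (regular K C))

section tensorLemmas

variable (C) (H : Type u) [AddCommGroup H] [Module K H]

/-- The map `id ⊗ Δ : H ⊗ C → (H ⊗ C) ⊗ C`. -/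
def tensorComul : H ⊗[K] C →ₗ[K] (H ⊗[K] C) ⊗[K] C :=
  (TensorProduct.assoc K H C C).symm.toLinearMap ∘ₗ Coalgebra.comul.lTensor H

/-- The map `id ⊗ ε : H ⊗ C → H`. -/
def tensorCounit : H ⊗[K] C →ₗ[K] H :=
  (TensorProduct.rid K H).toLinearMap ∘ₗ (Coalgebra.counit (R := K) (A := C)).lTensor H

variable {C H} {V : Type u} [AddCommGroup V] [Module K V]

theorem tensorComul_natural (f : H →ₗ[K] V) (t : H ⊗[K] C) :
    (f.rTensor C).rTensor C (tensorComul C H t) = tensorComul C V (f.rTensor C t) := by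
  induction t using TensorProduct.induction_on with
  | zero => simp
  | add a b ha hb => simp only [map_add, ha, hb]
  | tmul x c =>
    simp only [tensorComul, LinearMap.comp_apply, LinearMap.lTensor_tmul, LinearEquiv.coe_coe,
      LinearMap.rTensor_tmul]
    induction Coalgebra.comul (R := K) c using TensorProduct.induction_on with
    | zero => simp
    | add a b ha hb => simp only [map_add, TensorProduct.tmul_add, ha, hb]
    | tmul a b => simp

theorem tensorCounit_natural (f : H →ₗ[K] V) (t : H ⊗[K] C) :
    tensorCounit C V (f.rTensor C t) = f (tensorCounit C H t) := by
  induction t using TensorProduct.induction_on with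
  | zero => simp
  | add a b ha hb => simp only [map_add, ha, hb]
  | tmul x c => simp [tensorCounit]

theorem tensorComul_coassoc (t : H ⊗[K] C) :
    tensorComul C (H ⊗[K] C) (tensorComul C H t) =
      (tensorComul C H).rTensor C (tensorComul C H t) := by
  induction t using TensorProduct.induction_on with
  | zero => simp
  | add a b ha hb => simp only [map_add, ha, hb]
  | tmul x c =>
    let Φ : C ⊗[K] (C ⊗[K] C) →ₗ[K] ((H ⊗[K] C) ⊗[K] C) ⊗[K] C :=
      (TensorProduct.assoc K (H ⊗[K] C) C C).symm.toLinearMap ∘ₗ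
        (TensorProduct.mk K H C x).rTensor (C ⊗[K] C)
    have h1 : ∀ s : C ⊗[K] C, tensorComul C (H ⊗[K] C)
        ((TensorProduct.assoc K H C C).symm (x ⊗ₜ s)) = Φ (Coalgebra.comul.lTensor C s) := by
      intro s
      induction s using TensorProduct.induction_on with
      | zero => simp
      | add a b ha hb => simp only [map_add, TensorProduct.tmul_add, ha, hb]
      | tmul a b => simp [tensorComul, Φ]
    have h2 : ∀ s : C ⊗[K] C, (tensorComul C H).rTensor C
        ((TensorProduct.assoc K H C C).symm (x ⊗ₜ s)) =
          Φ (TensorProduct.assoc K C C C (Coalgebra.comul.rTensor C s)) := by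
      intro s
      induction s using TensorProduct.induction_on with
      | zero => simp
      | add a b ha hb => simp only [map_add, TensorProduct.tmul_add, ha, hb]
      | tmul a b =>
        simp only [tensorComul, LinearMap.comp_apply, LinearMap.lTensor_tmul, LinearEquiv.coe_coe,
          LinearMap.rTensor_tmul, TensorProduct.assoc_symm_tmul]
        induction Coalgebra.comul (R := K) a using TensorProduct.induction_on with
        | zero => simp
        | add a b ha hb =>
          simp only [map_add, TensorProduct.tmul_add, TensorProduct.add_tmul, ha, hb]
        | tmul a b => simp [Φ]
    have h3 : tensorComul C H (x ⊗ₜ[K] c) =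
        (TensorProduct.assoc K H C C).symm (x ⊗ₜ Coalgebra.comul c) := by
      simp [tensorComul]
    rw [h3, h1, h2, Coalgebra.coassoc_apply]

theorem tensorCounit_tensorComul (t : H ⊗[K] C) :
    tensorCounit C (H ⊗[K] C) (tensorComul C H t) = t := by
  induction t using TensorProduct.induction_on with
  | zero => simp
  | add a b ha hb => simp only [map_add, ha, hb]
  | tmul x c =>
    have h : ∀ s : C ⊗[K] C, tensorCounit C (H ⊗[K] C)
        ((TensorProduct.assoc K H C C).symm (x ⊗ₜ s)) =
          x ⊗ₜ TensorProduct.rid K C (Coalgebra.counit.lTensor C s) := by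
      intro s
      induction s using TensorProduct.induction_on with
      | zero => simp
      | add a b ha hb => simp only [map_add, TensorProduct.tmul_add, ha, hb]
      | tmul a b => simp [tensorCounit]
    have h3 : tensorComul C H (x ⊗ₜ[K] c) =
        (TensorProduct.assoc K H C C).symm (x ⊗ₜ Coalgebra.comul c) := by
      simp [tensorComul]
    rw [h3, h, Coalgebra.lTensor_counit_comul]
    simp

theorem tensorCounit_rTensor_tensorComul (t : H ⊗[K] C) :
    (tensorCounit C H).rTensor C (tensorComul C H t) = t := by
  induction t using TensorProduct.induction_on with
  | zero => simp
  | add a b ha hb => simp only [map_add, ha, hb]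
  | tmul x c =>
    have h : ∀ s : C ⊗[K] C, (tensorCounit C H).rTensor C
        ((TensorProduct.assoc K H C C).symm (x ⊗ₜ s)) =
          x ⊗ₜ TensorProduct.lid K C (Coalgebra.counit.rTensor C s) := by
      intro s
      induction s using TensorProduct.induction_on with
      | zero => simp
      | add a b ha hb => simp only [map_add, TensorProduct.tmul_add, ha, hb]
      | tmul a b => simp [tensorCounit, TensorProduct.smul_tmul]
    have h3 : tensorComul C H (x ⊗ₜ[K] c) =
        (TensorProduct.assoc K H C C).symm (x ⊗ₜ Coalgebra.comul c) := by
      simp [tensorComul]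
    rw [h3, h, Coalgebra.rTensor_counit_comul]
    simp

theorem coact_rTensor_coact (W : RightComodule K C) (w : W.carrier) :
    W.coact.rTensor C (W.coact w) = tensorComul C W.carrier (W.coact w) := by
  have h := LinearMap.congr_fun W.coassoc w
  simp only [LinearMap.comp_apply, LinearEquiv.coe_coe] at h
  simp only [tensorComul, LinearMap.comp_apply, LinearEquiv.coe_coe]
  rw [← h, LinearEquiv.symm_apply_apply]

theorem tensorCounit_coact (W : RightComodule K C) (w : W.carrier) :
    tensorCounit C W.carrier (W.coact w) = w :=
  LinearMap.congr_fun W.rid_counit w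

theorem tensorObj_regular_coact (α : C →ₗc[K] D) (t : H ⊗[K] C) :
    (tensorObj H (corestrictObj α (regular K C))).coact t =
      α.toLinearMap.lTensor (H ⊗[K] C) (tensorComul C H t) := by
  change (TensorProduct.assoc K H C D).symm
    ((α.toLinearMap.lTensor C ∘ₗ Coalgebra.comul).lTensor H t) = _
  induction t using TensorProduct.induction_on with
  | zero => simp
  | add a b ha hb => simp only [map_add, ha, hb]
  | tmul x c =>
    simp only [tensorComul, LinearMap.comp_apply, LinearMap.lTensor_tmul, LinearEquiv.coe_coe]
    induction Coalgebra.comul (R := K) c using TensorProduct.induction_on with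
    | zero => simp
    | add a b ha hb => simp only [map_add, TensorProduct.tmul_add, ha, hb]
    | tmul a b => simp

theorem lTensor_rTensor_swap {A B : Type u} [AddCommGroup A] [Module K A] [AddCommGroup B]
    [Module K B] (h : A →ₗ[K] B) (f : H →ₗ[K] V) (t : H ⊗[K] A) :
    h.lTensor V (f.rTensor A t) = f.rTensor B (h.lTensor H t) := by
  rw [← LinearMap.comp_apply, ← LinearMap.comp_apply, LinearMap.lTensor_comp_rTensor,
    LinearMap.rTensor_comp_lTensor]

end tensorLemmas

section shriek

variable (α : C →ₗc[K] D) [IsQuasiFiniteHom α] (M : RightComodule K D)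

/-- The vector space `H_D(C, M)`. -/
noncomputable abbrev shriekCarrier : Type u := (cohom (corestrictObj α (regular K C))).obj M

/-- The unit `M → H_D(C, M) ⊗ C`. -/
noncomputable def shriekUnit : M.carrier →ₗ[K] shriekCarrier α M ⊗[K] C :=
  cohomUnit (corestrictObj α (regular K C)) M

variable {α M} in
theorem shriek_hom_ext {V : Type u} [AddCommGroup V] [Module K V]
    {f g : shriekCarrier α M →ₗ[K] V}
    (h : f.rTensor C ∘ₗ shriekUnit α M = g.rTensor C ∘ₗ shriekUnit α M) : f = g :=
  cohom_hom_ext h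

/-- The unit is a morphism of `D`-comodules. -/
theorem shriekUnit_comm (m : M.carrier) :
    (shriekUnit α M).rTensor D (M.coact m) =
      α.toLinearMap.lTensor (shriekCarrier α M ⊗[K] C)
        (tensorComul C (shriekCarrier α M) (shriekUnit α M m)) := by
  rw [← tensorObj_regular_coact]
  exact (LinearMap.congr_fun
    (linMap_comm ((cohomAdj (corestrictObj α (regular K C))).unit.app M)) m).symm

/-- The map `(id ⊗ Δ) ∘ unit : M → (H_D(C, M) ⊗ C) ⊗ C`, as a morphism of `D`-comodules. -/
noncomputable def shriekAux :
    M ⟶ tensorObj (shriekCarrier α M ⊗[K] C) (corestrictObj α (regular K C)) :=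
  Hom.mk (M := M) (N := tensorObj (shriekCarrier α M ⊗[K] C) (corestrictObj α (regular K C)))
    (tensorComul C (shriekCarrier α M) ∘ₗ shriekUnit α M) (by
      ext m
      change (tensorObj (shriekCarrier α M ⊗[K] C) (corestrictObj α (regular K C))).coact
        (tensorComul C (shriekCarrier α M) (shriekUnit α M m)) =
          (tensorComul C (shriekCarrier α M) ∘ₗ shriekUnit α M).rTensor D (M.coact m)
      rw [LinearMap.rTensor_comp_apply, shriekUnit_comm, ← lTensor_rTensor_swap,
        ← tensorComul_coassoc]
      exact tensorObj_regular_coact α _)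

/-- The right `C`-coaction of `H_D(C, M)`: the linear map `ρ` determined by
`(ρ ⊗ id) ∘ unit = (id ⊗ Δ) ∘ unit`. -/
noncomputable def shriekCoact : shriekCarrier α M →ₗ[K] shriekCarrier α M ⊗[K] C :=
  cohomDesc (N := corestrictObj α (regular K C)) (shriekAux α M)

theorem shriekCoact_unit (m : M.carrier) :
    (shriekCoact α M).rTensor C (shriekUnit α M m) =
      tensorComul C (shriekCarrier α M) (shriekUnit α M m) :=
  LinearMap.congr_fun (cohomDesc_unit (N := corestrictObj α (regular K C)) (shriekAux α M)) m

/-- The comodule `α^! M = H_D(C, M)`. -/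
noncomputable def shriekObj : RightComodule K C where
  carrier := shriekCarrier α M
  coact := shriekCoact α M
  coassoc := by
    apply shriek_hom_ext
    ext m
    have h : (TensorProduct.assoc K (shriekCarrier α M) C C).toLinearMap ∘ₗ
        tensorComul C (shriekCarrier α M) = Coalgebra.comul.lTensor (shriekCarrier α M) := by
      ext x c
      simp [tensorComul]
    simp only [LinearMap.comp_apply, LinearMap.rTensor_comp_apply]
    rw [shriekCoact_unit, tensorComul_natural, shriekCoact_unit, tensorComul_coassoc,
      ← LinearMap.rTensor_comp_apply, h]
  rid_counit := by
    apply shriek_hom_ext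
    ext m
    change (tensorCounit C (shriekCarrier α M) ∘ₗ shriekCoact α M).rTensor C
      (shriekUnit α M m) = (LinearMap.id).rTensor C (shriekUnit α M m)
    rw [LinearMap.rTensor_comp_apply, shriekCoact_unit, tensorCounit_rTensor_tensorComul]
    simp

/-- The linear map `g ∘ (id ⊗ ε) ∘ unit : M → W` of a linear map `g : H_D(C, M) → W`. -/
noncomputable def shriekTranspose {V : Type u} [AddCommGroup V] [Module K V]
    (g : shriekCarrier α M →ₗ[K] V) : M.carrier →ₗ[K] V :=
  g ∘ₗ tensorCounit C (shriekCarrier α M) ∘ₗ shriekUnit α M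

theorem coact_shriekTranspose {W : RightComodule K C} (g : shriekObj α M ⟶ W) (m : M.carrier) :
    W.coact (shriekTranspose α M (linMap g) m) =
      LinearMap.rTensor C (linMap g) (shriekUnit α M m) := by
  have h := LinearMap.congr_fun (linMap_comm g)
    (tensorCounit C (shriekCarrier α M) (shriekUnit α M m))
  have h2 : shriekCoact α M (tensorCounit C (shriekCarrier α M) (shriekUnit α M m)) =
      shriekUnit α M m := by
    rw [← tensorCounit_natural, shriekCoact_unit, tensorCounit_tensorComul]
  refine h.trans ?_
  change LinearMap.rTensor C (linMap g) (shriekCoact α M _) = _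
  rw [h2]

/-- The morphism `M → W ⊗ C` of `D`-comodules given by `ρ ∘ f`, for `f : M → α^* W`. -/
noncomputable def shriekLift {W : RightComodule K C} (f : M ⟶ corestrictObj α W) :
    M ⟶ tensorObj W.carrier (corestrictObj α (regular K C)) :=
  Hom.mk (M := M) (N := tensorObj W.carrier (corestrictObj α (regular K C)))
    (W.coact ∘ₗ linMap f) (by
      ext m
      let f' : M.carrier →ₗ[K] W.carrier := linMap f
      have h : α.toLinearMap.lTensor W.carrier (W.coact (linMap f m)) =
          LinearMap.rTensor D (linMap f) (M.coact m) := LinearMap.congr_fun (linMap_comm f) m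
      have h2 : ∀ w : W.carrier,
          (tensorObj W.carrier (corestrictObj α (regular K C))).coact (W.coact w) =
            W.coact.rTensor D (α.toLinearMap.lTensor W.carrier (W.coact w)) := by
        intro w
        refine (tensorObj_regular_coact α (W.coact w)).trans ?_
        rw [← coact_rTensor_coact, lTensor_rTensor_swap]
      exact (h2 (linMap f m)).trans <| (congrArg (W.coact.rTensor D) h).trans
        (LinearMap.rTensor_comp_apply D W.coact f' (M.coact m)).symm)

theorem cohomDesc_shriekLift {W : RightComodule K C} (f : M ⟶ corestrictObj α W)
    (m : M.carrier) :
    (cohomDesc (N := corestrictObj α (regular K C)) (shriekLift α M f)).rTensor C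
      (shriekUnit α M m) = W.coact (linMap f m) :=
  LinearMap.congr_fun (cohomDesc_unit (N := corestrictObj α (regular K C)) (shriekLift α M f)) m

theorem shriekTranspose_comm {V : Type u} [AddCommGroup V] [Module K V]
    (g : shriekCarrier α M →ₗ[K] V) (m : M.carrier) :
    (shriekTranspose α M g).rTensor D (M.coact m) =
      α.toLinearMap.lTensor V (g.rTensor C (shriekUnit α M m)) := by
  rw [shriekTranspose, LinearMap.rTensor_comp_apply, LinearMap.rTensor_comp_apply,
    shriekUnit_comm, ← lTensor_rTensor_swap, tensorCounit_rTensor_tensorComul,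
    lTensor_rTensor_swap]

theorem cohomDesc_shriekLift_comm {W : RightComodule K C} (f : M ⟶ corestrictObj α W) :
    W.coact ∘ₗ cohomDesc (N := corestrictObj α (regular K C)) (shriekLift α M f) =
      (cohomDesc (N := corestrictObj α (regular K C)) (shriekLift α M f)).rTensor C ∘ₗ
        shriekCoact α M := by
  have h := cohomDesc_shriekLift α M f
  set g : shriekCarrier α M →ₗ[K] W.carrier :=
    cohomDesc (N := corestrictObj α (regular K C)) (shriekLift α M f)
  apply shriek_hom_ext
  ext m
  rw [LinearMap.comp_apply, LinearMap.comp_apply, LinearMap.rTensor_comp_apply,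
    LinearMap.rTensor_comp_apply, shriekCoact_unit, tensorComul_natural]
  exact (congrArg (W.coact.rTensor C) (h m)).trans
    ((coact_rTensor_coact W _).trans (congrArg (tensorComul C W.carrier) (h m)).symm)

/-- The bijection between morphisms `α^! M → W` of `C`-comodules and morphisms `M → α^* W` of
`D`-comodules: `g` corresponds to `g ∘ (id ⊗ ε) ∘ unit`. -/
noncomputable def shriekEquiv (W : RightComodule K C) :
    (shriekObj α M ⟶ W) ≃ (M ⟶ corestrictObj α W) where
  toFun g := Hom.mk (M := M) (N := corestrictObj α W) (shriekTranspose α M (linMap g)) (by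
    ext m
    exact (congrArg (α.toLinearMap.lTensor W.carrier) (coact_shriekTranspose α M g m)).trans
      (shriekTranspose_comm α M (linMap g) m).symm)
  invFun f := Hom.mk (M := shriekObj α M) (N := W)
    (cohomDesc (N := corestrictObj α (regular K C)) (shriekLift α M f))
    (cohomDesc_shriekLift_comm α M f)
  left_inv g := by
    apply hom_ext
    apply shriek_hom_ext
    ext m
    exact (cohomDesc_shriekLift α M _ m).trans (coact_shriekTranspose α M g m)
  right_inv f := by
    apply hom_ext
    ext m
    have h := (tensorCounit_natural
      (cohomDesc (N := corestrictObj α (regular K C)) (shriekLift α M f))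
      (shriekUnit α M m)).symm
    exact h.trans ((congrArg (tensorCounit C W.carrier) (cohomDesc_shriekLift α M f m)).trans
      (tensorCounit_coact W _))

end shriek

/-- The functor `α^! = H_D(C, -) : M^D ⥤ M^C` of a quasi-finite morphism `α : C → D`. -/
noncomputable def shriek (α : C →ₗc[K] D) [IsQuasiFiniteHom α] :
    RightComodule K D ⥤ RightComodule K C :=
  Adjunction.leftAdjointOfEquiv (G := corestrict α) (F_obj := shriekObj α) (shriekEquiv α) (fun _ _ _ _ _ => rfl)

/-- The functor `α^!` is left adjoint to the corestriction functor `α^*`. -/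
noncomputable def shriekAdj (α : C →ₗc[K] D) [IsQuasiFiniteHom α] : shriek α ⊣ corestrict α :=
  Adjunction.adjunctionOfEquivLeft (G := corestrict α) (F_obj := shriekObj α) (shriekEquiv α) (fun _ _ _ _ _ => rfl)

/-- The left coaction `N → C ⊗ N` obtained from the right coaction by the flip; it makes a right
comodule over a cocommutative coalgebra a bicomodule. -/
def leftCoact (N : RightComodule K C) : N.carrier →ₗ[K] C ⊗[K] N.carrier :=
  (TensorProduct.comm K N.carrier C).toLinearMap ∘ₗ N.coact

/-- The quotient of a comodule `P` by a subspace `S` such that the coaction of `P` descends to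
`P ⧸ S`. -/
def quotient (P : RightComodule K C) (S : Submodule K P.carrier)
    (hS : S ≤ LinearMap.ker (S.mkQ.rTensor C ∘ₗ P.coact)) : RightComodule K C where
  carrier := P.carrier ⧸ S
  coact := S.liftQ (S.mkQ.rTensor C ∘ₗ P.coact) hS
  coassoc := by
    apply Submodule.linearMap_qext
    ext p
    have h1 : (S.liftQ (S.mkQ.rTensor C ∘ₗ P.coact) hS) ∘ₗ S.mkQ = S.mkQ.rTensor C ∘ₗ P.coact :=
      Submodule.liftQ_mkQ _ _ _
    have h2 : (TensorProduct.assoc K (P.carrier ⧸ S) C C).toLinearMap ∘ₗ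
        tensorComul C (P.carrier ⧸ S) = Coalgebra.comul.lTensor (P.carrier ⧸ S) := by
      ext x c
      simp [tensorComul]
    have h3 := LinearMap.congr_fun h1 p
    simp only [LinearMap.comp_apply] at h3 ⊢
    rw [h3, ← LinearMap.rTensor_comp_apply, h1, LinearMap.rTensor_comp_apply, coact_rTensor_coact,
      tensorComul_natural, ← h2, LinearMap.comp_apply]
  rid_counit := by
    apply Submodule.linearMap_qext
    ext p
    have h3 := LinearMap.congr_fun (Submodule.liftQ_mkQ S (S.mkQ.rTensor C ∘ₗ P.coact) hS) p
    simp only [LinearMap.comp_apply] at h3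
    change tensorCounit C (P.carrier ⧸ S) (S.liftQ (S.mkQ.rTensor C ∘ₗ P.coact) hS (S.mkQ p)) =
      S.mkQ p
    rw [h3, tensorCounit_natural, tensorCounit_coact]

end RightComodule

/-! ### Right contramodules -/

/-- A right contramodule over a `K`-coalgebra `C`: a vector space with a contraaction
`π : Hom(C, M) → M` that is counital and contraassociative, where `Hom(C, Hom(C, M))` is identified
with `Hom(C ⊗ C, M)` by `F ↦ (c ⊗ d ↦ F c d)`. -/
structure RightContramodule (K : Type u) [Field K] (C : Type u) [AddCommGroup C] [Module K C]
    [Coalgebra K C] where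
  carrier : Type u
  [addCommGroup : AddCommGroup carrier]
  [module : Module K carrier]
  act : (C →ₗ[K] carrier) →ₗ[K] carrier
  act_counit : ∀ m : carrier, act ((Coalgebra.counit (R := K) (A := C)).smulRight m) = m
  act_assoc : ∀ F : C →ₗ[K] (C →ₗ[K] carrier),
    act (act ∘ₗ F) = act (TensorProduct.lift F ∘ₗ Coalgebra.comul)

attribute [instance] RightContramodule.addCommGroup RightContramodule.module

namespace RightContramodule

variable {K : Type u} [Field K]
variable {C : Type u} [AddCommGroup C] [Module K C] [Coalgebra K C]
variable {D : Type u} [AddCommGroup D] [Module K D] [Coalgebra K D]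

/-- A morphism of right contramodules: a linear map that commutes with the contraactions. -/
@[ext]
structure Hom (M N : RightContramodule K C) where
  lin : M.carrier →ₗ[K] N.carrier
  comm : ∀ f : C →ₗ[K] M.carrier, lin (M.act f) = N.act (lin ∘ₗ f)

/-- The category of right `C`-contramodules. -/
instance : Category (RightContramodule K C) where
  Hom M N := Hom M N
  id M := ⟨LinearMap.id, fun _ => rfl⟩
  comp f g := ⟨g.lin ∘ₗ f.lin, fun h => by
    rw [LinearMap.comp_apply, f.comm, g.comm, LinearMap.comp_assoc]⟩

/-- The underlying linear map of a morphism of contramodules. -/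
def linMap {M N : RightContramodule K C} (f : M ⟶ N) : M.carrier →ₗ[K] N.carrier := Hom.lin f

/-- The contrarestriction `α_• M` of a right `C`-contramodule along a morphism `α : C → D` of
coalgebras: the contraaction is `f ↦ π (f ∘ α)`. -/
def contrarestrictObj (α : C →ₗc[K] D) (M : RightContramodule K C) : RightContramodule K D where
  carrier := M.carrier
  act := M.act ∘ₗ LinearMap.lcomp K M.carrier α.toLinearMap
  act_counit m := by
    have h : (LinearMap.lcomp K M.carrier α.toLinearMap)
        ((Coalgebra.counit (R := K) (A := D)).smulRight m) =
          (Coalgebra.counit (R := K) (A := C)).smulRight m := by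
      ext c
      simp
    rw [LinearMap.comp_apply, h, M.act_counit]
  act_assoc F := by
    have h := M.act_assoc (LinearMap.lcomp K M.carrier α.toLinearMap ∘ₗ F ∘ₗ α.toLinearMap)
    have h2 : TensorProduct.lift (LinearMap.lcomp K M.carrier α.toLinearMap ∘ₗ F ∘ₗ α.toLinearMap) =
        TensorProduct.lift F ∘ₗ TensorProduct.map α.toLinearMap α.toLinearMap := by
      ext c d
      simp
    have h3 : (TensorProduct.map α.toLinearMap α.toLinearMap) ∘ₗ
        Coalgebra.comul (R := K) (A := C) = Coalgebra.comul ∘ₗ α.toLinearMap :=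
      α.map_comp_comul
    rw [h2, LinearMap.comp_assoc, h3] at h
    exact h

/-- The contrarestriction functor `α_•` along a morphism `α : C → D` of coalgebras. -/
def contrarestrict (α : C →ₗc[K] D) : RightContramodule K C ⥤ RightContramodule K D where
  obj M := contrarestrictObj α M
  map {M N} f := Hom.mk (M := contrarestrictObj α M) (N := contrarestrictObj α N) (linMap f :)
    (fun g => Hom.comm f (g ∘ₗ α.toLinearMap))

end RightContramodule

/-! ### Contratensor product and the contramodule of comodule morphisms -/

section

variable {K : Type u} [Field K]
variable {C : Type u} [AddCommGroup C] [Module K C] [Coalgebra K C]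

open RightComodule

/-- The map `Hom(C, M) ⊗ N → M ⊗ N` induced by the coaction `N → C ⊗ N` and evaluation. -/
def contratensorEval (M : RightContramodule K C) (N : RightComodule K C) :
    (C →ₗ[K] M.carrier) ⊗[K] N.carrier →ₗ[K] M.carrier ⊗[K] N.carrier :=
  (TensorProduct.lift (LinearMap.id : (C →ₗ[K] M.carrier) →ₗ[K] (C →ₗ[K] M.carrier))).rTensor
      N.carrier ∘ₗ
    (TensorProduct.assoc K (C →ₗ[K] M.carrier) C N.carrier).symm.toLinearMap ∘ₗ
      (leftCoact N).lTensor (C →ₗ[K] M.carrier)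

/-- The subspace of `M ⊗ N` whose quotient is the coequalizer of the two maps
`Hom(C, M) ⊗ N → M ⊗ N`. -/
def contratensorRel (M : RightContramodule K C) (N : RightComodule K C) :
    Submodule K (M.carrier ⊗[K] N.carrier) :=
  LinearMap.range (M.act.rTensor N.carrier - contratensorEval M N)

/-- The coaction of `C` on `V ⊗ N` through `N`. -/
def tensorCoact (V : Type u) [AddCommGroup V] [Module K V] (N : RightComodule K C) :
    V ⊗[K] N.carrier →ₗ[K] (V ⊗[K] N.carrier) ⊗[K] C :=
  (TensorProduct.assoc K V N.carrier C).symm.toLinearMap ∘ₗ N.coact.lTensor V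

theorem coact_swap [Coalgebra.IsCocomm K C] (N : RightComodule K C) (n : N.carrier) :
    (TensorProduct.comm K C C).toLinearMap.lTensor N.carrier
        (TensorProduct.assoc K N.carrier C C (N.coact.rTensor C (N.coact n))) =
      TensorProduct.assoc K N.carrier C C (N.coact.rTensor C (N.coact n)) := by
  have h := LinearMap.congr_fun N.coassoc n
  simp only [LinearMap.comp_apply, LinearEquiv.coe_coe] at h
  rw [h, ← LinearMap.lTensor_comp_apply, Coalgebra.IsCocomm.comm_comp_comul]

theorem contratensorEval_coact [Coalgebra.IsCocomm K C] (M : RightContramodule K C)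
    (N : RightComodule K C) :
    tensorCoact M.carrier N ∘ₗ contratensorEval M N =
      (contratensorEval M N).rTensor C ∘ₗ tensorCoact (C →ₗ[K] M.carrier) N := by
  ext f n
  let Ψ : N.carrier ⊗[K] (C ⊗[K] C) →ₗ[K] (M.carrier ⊗[K] N.carrier) ⊗[K] C :=
    ((TensorProduct.comm K N.carrier M.carrier).toLinearMap ∘ₗ f.lTensor N.carrier).rTensor C ∘ₗ
      (TensorProduct.assoc K N.carrier C C).symm.toLinearMap
  have h1 : ∀ t : N.carrier ⊗[K] C, (contratensorEval M N).rTensor C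
      ((TensorProduct.assoc K (C →ₗ[K] M.carrier) N.carrier C).symm (f ⊗ₜ t)) =
        Ψ (TensorProduct.assoc K N.carrier C C (N.coact.rTensor C t)) := by
    intro t
    induction t using TensorProduct.induction_on with
    | zero => simp
    | add a b ha hb => simp only [map_add, TensorProduct.tmul_add, ha, hb]
    | tmul a c =>
      simp only [contratensorEval, leftCoact, LinearMap.comp_apply, LinearMap.lTensor_tmul,
        LinearEquiv.coe_coe, LinearMap.rTensor_tmul, TensorProduct.assoc_symm_tmul]
      induction N.coact a using TensorProduct.induction_on with
      | zero => simp
      | add a b ha hb =>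
        simp only [map_add, TensorProduct.tmul_add, TensorProduct.add_tmul, ha, hb]
      | tmul a b => simp [Ψ]
  have h2 : ∀ t : N.carrier ⊗[K] C, tensorCoact M.carrier N
      ((TensorProduct.comm K N.carrier M.carrier) (f.lTensor N.carrier t)) =
        Ψ ((TensorProduct.comm K C C).toLinearMap.lTensor N.carrier
          (TensorProduct.assoc K N.carrier C C (N.coact.rTensor C t))) := by
    intro t
    induction t using TensorProduct.induction_on with
    | zero => simp
    | add a b ha hb => simp only [map_add, ha, hb]
    | tmul a c =>
      simp only [tensorCoact, LinearMap.comp_apply, LinearMap.lTensor_tmul,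
        LinearEquiv.coe_coe, LinearMap.rTensor_tmul, TensorProduct.comm_tmul]
      induction N.coact a using TensorProduct.induction_on with
      | zero => simp
      | add a b ha hb =>
        simp only [map_add, TensorProduct.tmul_add, TensorProduct.add_tmul, ha, hb]
      | tmul a b => simp [Ψ]
  have h3 : contratensorEval M N (f ⊗ₜ n) =
      (TensorProduct.comm K N.carrier M.carrier) (f.lTensor N.carrier (N.coact n)) := by
    simp only [contratensorEval, leftCoact, LinearMap.comp_apply, LinearMap.lTensor_tmul,
      LinearEquiv.coe_coe]
    induction N.coact n using TensorProduct.induction_on with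
    | zero => simp
    | add a b ha hb => simp only [map_add, TensorProduct.tmul_add, ha, hb]
    | tmul a b => simp
  have h4 : tensorCoact (C →ₗ[K] M.carrier) N (f ⊗ₜ n) =
      (TensorProduct.assoc K (C →ₗ[K] M.carrier) N.carrier C).symm (f ⊗ₜ N.coact n) := by
    simp [tensorCoact]
  simp only [TensorProduct.AlgebraTensorModule.curry_apply, LinearMap.restrictScalars_self,
    TensorProduct.curry_apply, LinearMap.comp_apply]
  rw [h3, h2, coact_swap, h4, h1]

theorem tensorCoact_natural {V W : Type u} [AddCommGroup V] [Module K V] [AddCommGroup W]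
    [Module K W] (f : V →ₗ[K] W) (N : RightComodule K C) :
    tensorCoact W N ∘ₗ f.rTensor N.carrier =
      (f.rTensor N.carrier).rTensor C ∘ₗ tensorCoact V N := by
  ext v n
  simp only [tensorCoact, TensorProduct.AlgebraTensorModule.curry_apply,
    LinearMap.restrictScalars_self, TensorProduct.curry_apply, LinearMap.comp_apply,
    LinearMap.lTensor_tmul, LinearMap.rTensor_tmul, LinearEquiv.coe_coe]
  induction N.coact n using TensorProduct.induction_on with
  | zero => simp
  | add a b ha hb => simp only [map_add, TensorProduct.tmul_add, ha, hb]
  | tmul n c => simp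

theorem contratensorRel_le [Coalgebra.IsCocomm K C] (M : RightContramodule K C)
    (N : RightComodule K C) :
    contratensorRel M N ≤
      LinearMap.ker ((contratensorRel M N).mkQ.rTensor C ∘ₗ (tensorObj M.carrier N).coact) := by
  rintro _ ⟨t, rfl⟩
  change (contratensorRel M N).mkQ.rTensor C (tensorCoact M.carrier N
    ((M.act.rTensor N.carrier - contratensorEval M N) t)) = 0
  have h : tensorCoact M.carrier N ∘ₗ (M.act.rTensor N.carrier - contratensorEval M N) =
      (M.act.rTensor N.carrier - contratensorEval M N).rTensor C ∘ₗ
        tensorCoact (C →ₗ[K] M.carrier) N := by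
    rw [LinearMap.comp_sub, tensorCoact_natural, contratensorEval_coact, LinearMap.rTensor_sub,
      LinearMap.sub_comp]
  have h2 : (contratensorRel M N).mkQ ∘ₗ (M.act.rTensor N.carrier - contratensorEval M N) = 0 :=
    LinearMap.range_mkQ_comp _
  have h3 := LinearMap.congr_fun h t
  refine (congrArg ((contratensorRel M N).mkQ.rTensor C) h3).trans ?_
  rw [LinearMap.comp_apply, ← LinearMap.rTensor_comp_apply, h2]
  simp

/-- The contratensor product `M ⊠_C N` of a contramodule and a comodule over a cocommutative
coalgebra: the coequalizer of the two maps `Hom(C, M) ⊗ N → M ⊗ N`, with the coaction induced by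
that of `N`. -/
def contratensor [Coalgebra.IsCocomm K C] (M : RightContramodule K C) (N : RightComodule K C) :
    RightComodule K C :=
  (tensorObj M.carrier N).quotient (contratensorRel M N) (contratensorRel_le M N)

/-- The class of `m ⊗ n` in `M ⊠_C N`. -/
def contratensor.tmul [Coalgebra.IsCocomm K C] {M : RightContramodule K C} {N : RightComodule K C}
    (m : M.carrier) (n : N.carrier) : (contratensor M N).carrier :=
  (contratensorRel M N).mkQ (m ⊗ₜ[K] n)

/-- For `f : C → Hom_C(N, P)`, the linear map `n ↦ f(n₍₋₁₎)(n₍₀₎)`. -/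
def comHomActAux (N P : RightComodule K C) :
    (C →ₗ[K] homs N P) →ₗ[K] (N.carrier →ₗ[K] P.carrier) where
  toFun f := TensorProduct.lift ((homs N P).subtype ∘ₗ f) ∘ₗ leftCoact N
  map_add' f g := by
    ext n
    simp only [LinearMap.comp_apply, LinearMap.add_apply, LinearMap.comp_add]
    induction leftCoact N n using TensorProduct.induction_on with
    | zero => simp
    | add a b ha hb => simp only [map_add, ha, hb]; abel
    | tmul a b => simp
  map_smul' c f := by
    ext n
    simp only [LinearMap.comp_apply, LinearMap.smul_apply, LinearMap.comp_smul, RingHom.id_apply]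
    induction leftCoact N n using TensorProduct.induction_on with
    | zero => simp
    | add a b ha hb => simp only [map_add, ha, hb, smul_add]
    | tmul a b => simp

theorem comHomActAux_apply (N P : RightComodule K C) (f : C →ₗ[K] homs N P) (n : N.carrier) :
    comHomActAux N P f n =
      TensorProduct.lift ((homs N P).subtype ∘ₗ f)
        (TensorProduct.comm K N.carrier C (N.coact n)) := rfl

theorem comHomActAux_mem [Coalgebra.IsCocomm K C] (N P : RightComodule K C)
    (f : C →ₗ[K] homs N P) : comHomActAux N P f ∈ homs N P := by
  change P.coact ∘ₗ comHomActAux N P f = (comHomActAux N P f).rTensor C ∘ₗ N.coact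
  ext n
  let e : N.carrier ⊗[K] C →ₗ[K] P.carrier :=
    TensorProduct.lift ((homs N P).subtype ∘ₗ f) ∘ₗ (TensorProduct.comm K N.carrier C).toLinearMap
  let Ψ : N.carrier ⊗[K] (C ⊗[K] C) →ₗ[K] P.carrier ⊗[K] C :=
    e.rTensor C ∘ₗ (TensorProduct.assoc K N.carrier C C).symm.toLinearMap
  have h1 : ∀ t : N.carrier ⊗[K] C, (comHomActAux N P f).rTensor C t =
      Ψ (TensorProduct.assoc K N.carrier C C (N.coact.rTensor C t)) := by
    intro t
    induction t using TensorProduct.induction_on with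
    | zero => simp
    | add a b ha hb => simp only [map_add, ha, hb]
    | tmul a c => simp [Ψ, e, comHomActAux_apply]
  have h2 : ∀ t : N.carrier ⊗[K] C, P.coact (e t) =
      Ψ ((TensorProduct.comm K C C).toLinearMap.lTensor N.carrier
        (TensorProduct.assoc K N.carrier C C (N.coact.rTensor C t))) := by
    intro t
    induction t using TensorProduct.induction_on with
    | zero => simp
    | add a b ha hb => simp only [map_add, ha, hb]
    | tmul a c =>
      have h : P.coact ((f c : N.carrier →ₗ[K] P.carrier) a) =
          (f c : N.carrier →ₗ[K] P.carrier).rTensor C (N.coact a) :=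
        LinearMap.congr_fun (f c).2 a
      have h' : e (a ⊗ₜ c) = (f c : N.carrier →ₗ[K] P.carrier) a := by simp [e]
      rw [h', h, LinearMap.rTensor_tmul]
      induction N.coact a using TensorProduct.induction_on with
      | zero => simp
      | add a b ha hb => simp only [map_add, TensorProduct.add_tmul, ha, hb]
      | tmul a b => simp [Ψ, e]
  rw [LinearMap.comp_apply, LinearMap.comp_apply, h1, ← coact_swap, ← h2]
  rfl

/-- The right contramodule `Hom_C(N, P)` of morphisms of right comodules over a cocommutative
coalgebra `C`, with the contraaction `π(f)(n) = f(n₍₋₁₎)(n₍₀₎)`. -/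
def comHom [Coalgebra.IsCocomm K C] (N P : RightComodule K C) : RightContramodule K C where
  carrier := homs N P
  act := LinearMap.codRestrict (homs N P) (comHomActAux N P) (comHomActAux_mem N P)
  act_counit φ := by
    apply Subtype.ext
    ext n
    change comHomActAux N P (Coalgebra.counit.smulRight φ) n = φ.1 n
    have h : ∀ t : N.carrier ⊗[K] C,
        TensorProduct.lift ((homs N P).subtype ∘ₗ Coalgebra.counit.smulRight φ)
          (TensorProduct.comm K N.carrier C t) = φ.1 (tensorCounit C N.carrier t) := by
      intro t
      induction t using TensorProduct.induction_on with
      | zero => simp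
      | add a b ha hb => simp only [map_add, ha, hb]
      | tmul a c => simp [tensorCounit]
    rw [comHomActAux_apply, h, tensorCounit_coact]
  act_assoc F := by
    apply Subtype.ext
    ext n
    let act := LinearMap.codRestrict (homs N P) (comHomActAux N P) (comHomActAux_mem N P)
    change comHomActAux N P (act ∘ₗ F) n =
      comHomActAux N P (TensorProduct.lift F ∘ₗ Coalgebra.comul) n
    let Ψ : N.carrier ⊗[K] (C ⊗[K] C) →ₗ[K] P.carrier :=
      TensorProduct.lift ((homs N P).subtype ∘ₗ TensorProduct.lift F) ∘ₗ
        (TensorProduct.comm K N.carrier (C ⊗[K] C)).toLinearMap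
    have h1 : ∀ t : N.carrier ⊗[K] C,
        TensorProduct.lift ((homs N P).subtype ∘ₗ act ∘ₗ F) (TensorProduct.comm K N.carrier C t) =
          Ψ ((TensorProduct.comm K C C).toLinearMap.lTensor N.carrier
            (TensorProduct.assoc K N.carrier C C (N.coact.rTensor C t))) := by
      intro t
      induction t using TensorProduct.induction_on with
      | zero => simp
      | add a b ha hb => simp only [map_add, ha, hb]
      | tmul a c =>
        have h : TensorProduct.lift ((homs N P).subtype ∘ₗ act ∘ₗ F)
            (TensorProduct.comm K N.carrier C (a ⊗ₜ c)) = comHomActAux N P (F c) a := rfl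
        rw [h, comHomActAux_apply, LinearMap.rTensor_tmul]
        induction N.coact a using TensorProduct.induction_on with
        | zero => simp
        | add a b ha hb => simp only [map_add, TensorProduct.add_tmul, ha, hb]
        | tmul a b => simp [Ψ]
    have h2 : ∀ t : N.carrier ⊗[K] C,
        TensorProduct.lift ((homs N P).subtype ∘ₗ TensorProduct.lift F ∘ₗ Coalgebra.comul)
          (TensorProduct.comm K N.carrier C t) = Ψ (Coalgebra.comul.lTensor N.carrier t) := by
      intro t
      induction t using TensorProduct.induction_on with
      | zero => simp
      | add a b ha hb => simp only [map_add, ha, hb]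
      | tmul a c => simp [Ψ]
    have h3 := LinearMap.congr_fun N.coassoc n
    simp only [LinearMap.comp_apply, LinearEquiv.coe_coe] at h3
    rw [comHomActAux_apply, comHomActAux_apply, h1, h2, coact_swap, h3]

end

/-! ### Trans-comodules and trans-contramodules over a coalgebra representation -/

section

variable {K : Type u} [Field K] {X : Type w₁} [Category.{w₂} X]

/-- A trans-comodule over a coalgebra representation `𝒞`: comodules `M_x` over `𝒞_x` with
morphisms `M_y → α^* M_x` for the morphisms `α : x → y`, compatible with identities and
composition. -/
structure TransComodule (𝒞 : X ⥤ CoalgCat.{u} K) where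
  obj : ∀ x : X, RightComodule K (𝒞.obj x)
  map : ∀ {x y : X} (α : x ⟶ y),
    obj y ⟶ (RightComodule.corestrict (𝒞.map α).toCoalgHom).obj (obj x)
  map_id : ∀ (x : X) (m : (obj x).carrier), RightComodule.linMap (map (𝟙 x)) m = m
  map_comp : ∀ {x y z : X} (α : x ⟶ y) (β : y ⟶ z) (m : (obj z).carrier),
    RightComodule.linMap (map (α ≫ β)) m =
      RightComodule.linMap (map α) (RightComodule.linMap (map β) m)

/-- A trans-contramodule over a coalgebra representation `𝒞`: contramodules `M_x` over `𝒞_x` with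
morphisms `M_y → α_• M_x` for the morphisms `α : x → y`, compatible with identities and
composition. -/
structure TransContramodule (𝒞 : X ⥤ CoalgCat.{u} K) where
  obj : ∀ x : X, RightContramodule K (𝒞.obj x)
  map : ∀ {x y : X} (α : x ⟶ y),
    obj y ⟶ (RightContramodule.contrarestrict (𝒞.map α).toCoalgHom).obj (obj x)
  map_id : ∀ (x : X) (m : (obj x).carrier), RightContramodule.linMap (map (𝟙 x)) m = m
  map_comp : ∀ {x y z : X} (α : x ⟶ y) (β : y ⟶ z) (m : (obj z).carrier),
    RightContramodule.linMap (map (α ≫ β)) m =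
      RightContramodule.linMap (map α) (RightContramodule.linMap (map β) m)

/-- A coalgebra representation is quasi-finite if each `𝒞_α : 𝒞_x → 𝒞_y` makes `𝒞_x` a quasi-finite
right comodule over `𝒞_y`. -/
class IsQuasiFiniteRep (𝒞 : X ⥤ CoalgCat.{u} K) : Prop where
  isQuasiFiniteHom : ∀ {x y : X} (α : x ⟶ y),
    RightComodule.IsQuasiFiniteHom (𝒞.map α).toCoalgHom

attribute [instance] IsQuasiFiniteRep.isQuasiFiniteHom

variable {𝒞 : X ⥤ CoalgCat.{u} K}

namespace TransComodule

/-- A morphism of trans-comodules: morphisms of comodules at each object that commute with the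
structure morphisms. -/
@[ext]
structure Hom (M N : TransComodule 𝒞) where
  app : ∀ x : X, M.obj x ⟶ N.obj x
  naturality : ∀ {x y : X} (α : x ⟶ y),
    app y ≫ N.map α =
      M.map α ≫ (RightComodule.corestrict (𝒞.map α).toCoalgHom).map (app x)

/-- The category of trans-comodules over `𝒞`. -/
instance : Category (TransComodule 𝒞) where
  Hom M N := Hom M N
  id M := ⟨fun x => 𝟙 _, by simp⟩
  comp f g := ⟨fun x => f.app x ≫ g.app x, fun α => by
    rw [Category.assoc, g.naturality, Functor.map_comp, ← Category.assoc, f.naturality,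
      Category.assoc]⟩

/-- The component at `x` of a morphism of trans-comodules. -/
def app {M N : TransComodule 𝒞} (f : M ⟶ N) (x : X) : M.obj x ⟶ N.obj x := Hom.app f x

/-- The morphism `α^! M_y → M_x` that corresponds to the structure morphism `M_y → α^* M_x`. -/
noncomputable def shriekMap [IsQuasiFiniteRep 𝒞] (M : TransComodule 𝒞) {x y : X} (α : x ⟶ y) :
    (RightComodule.shriek (𝒞.map α).toCoalgHom).obj (M.obj y) ⟶ M.obj x :=
  ((RightComodule.shriekAdj (𝒞.map α).toCoalgHom).homEquiv _ _).symm (M.map α)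

/-- A trans-comodule over a quasi-finite representation is cartesian if all the morphisms
`α^! M_y → M_x` are isomorphisms. -/
def IsCartesian [IsQuasiFiniteRep 𝒞] (M : TransComodule 𝒞) : Prop :=
  ∀ ⦃x y : X⦄ (α : x ⟶ y), IsIso (M.shriekMap α)

end TransComodule

namespace TransContramodule

/-- A morphism of trans-contramodules: morphisms of contramodules at each object that commute with
the structure morphisms. -/
@[ext]
structure Hom (M N : TransContramodule 𝒞) where
  app : ∀ x : X, M.obj x ⟶ N.obj x
  naturality : ∀ {x y : X} (α : x ⟶ y),
    app y ≫ N.map α =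
      M.map α ≫ (RightContramodule.contrarestrict (𝒞.map α).toCoalgHom).map (app x)

/-- The category of trans-contramodules over `𝒞`. -/
instance : Category (TransContramodule 𝒞) where
  Hom M N := Hom M N
  id M := ⟨fun x => 𝟙 _, by simp⟩
  comp f g := ⟨fun x => f.app x ≫ g.app x, fun α => by
    rw [Category.assoc, g.naturality, Functor.map_comp, ← Category.assoc, f.naturality,
      Category.assoc]⟩

/-- The component at `x` of a morphism of trans-contramodules. -/
def app {M N : TransContramodule 𝒞} (f : M ⟶ N) (x : X) : M.obj x ⟶ N.obj x := Hom.app f x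

end TransContramodule

/-- `F` is the functor `M ↦ (M_x ⊠ N_x)_x`: for `α : y → x`, the structure morphism
`M_x ⊠ N_x → α^* (M_y ⊠ N_y)` sends the class of `m ⊗ n` to the class of `M_α m ⊗ N_α n`, and
`F` sends a morphism `φ` to the morphism with components `φ_x ⊠ id`. -/
structure IsContratensorFunctor [∀ x, Coalgebra.IsCocomm K (𝒞.obj x)] (N : TransComodule 𝒞)
    (F : TransContramodule 𝒞 ⥤ TransComodule 𝒞) : Prop where
  obj_eq : ∀ (M : TransContramodule 𝒞) (x : X),
    (F.obj M).obj x = contratensor (M.obj x) (N.obj x)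
  map_eq : ∀ (M : TransContramodule 𝒞) {y x : X} (α : y ⟶ x),
    ∃ f : contratensor (M.obj x) (N.obj x) ⟶
        (RightComodule.corestrict (𝒞.map α).toCoalgHom).obj (contratensor (M.obj y) (N.obj y)),
      (∀ (m : (M.obj x).carrier) (n : (N.obj x).carrier),
        RightComodule.linMap f (contratensor.tmul m n) =
          contratensor.tmul (M := M.obj y) (N := N.obj y)
            (RightContramodule.linMap (M.map α) m) (RightComodule.linMap (N.map α) n)) ∧
      (F.obj M).map α = eqToHom (obj_eq M x) ≫ f ≫
        (RightComodule.corestrict (𝒞.map α).toCoalgHom).map (eqToHom (obj_eq M y).symm)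
  hom_eq : ∀ {M M' : TransContramodule 𝒞} (φ : M ⟶ M') (x : X),
    ∃ f : contratensor (M.obj x) (N.obj x) ⟶ contratensor (M'.obj x) (N.obj x),
      (∀ (m : (M.obj x).carrier) (n : (N.obj x).carrier),
        RightComodule.linMap f (contratensor.tmul m n) =
          contratensor.tmul (RightContramodule.linMap (TransContramodule.app φ x) m) n) ∧
      TransComodule.app (F.map φ) x =
        eqToHom (obj_eq M x) ≫ f ≫ eqToHom (obj_eq M' x).symm

/-- `G` is the functor `P ↦ (Hom(N_x, P_x))_x`, for a cartesian `N`: for `α : y → x`, the structure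
morphism `Hom(N_x, P_x) → α_• Hom(N_y, P_y)` sends `φ` to the composite
`N_y ≅ α^! N_x → α^! P_x → P_y`, where the middle map is `α^! φ`, and `G` sends a morphism `ψ` to
the morphism with components `φ ↦ ψ_x ∘ φ`. -/
structure IsComHomFunctor [∀ x, Coalgebra.IsCocomm K (𝒞.obj x)] [IsQuasiFiniteRep 𝒞]
    (N : TransComodule 𝒞) (G : TransComodule 𝒞 ⥤ TransContramodule 𝒞) : Prop where
  obj_eq : ∀ (P : TransComodule 𝒞) (x : X),
    (G.obj P).obj x = comHom (N.obj x) (P.obj x)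
  map_eq : ∀ (P : TransComodule 𝒞) {y x : X} (α : y ⟶ x),
    ∃ g : comHom (N.obj x) (P.obj x) ⟶
        (RightContramodule.contrarestrict (𝒞.map α).toCoalgHom).obj (comHom (N.obj y) (P.obj y)),
      (∀ φ : RightComodule.homs (N.obj x) (P.obj x),
        N.shriekMap α ≫ RightComodule.ofHoms (RightContramodule.linMap g φ) =
          (RightComodule.shriek (𝒞.map α).toCoalgHom).map (RightComodule.ofHoms φ) ≫
            P.shriekMap α) ∧
      (G.obj P).map α = eqToHom (obj_eq P x) ≫ g ≫
        (RightContramodule.contrarestrict (𝒞.map α).toCoalgHom).map (eqToHom (obj_eq P y).symm)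
  hom_eq : ∀ {P P' : TransComodule 𝒞} (ψ : P ⟶ P') (x : X),
    ∃ g : comHom (N.obj x) (P.obj x) ⟶ comHom (N.obj x) (P'.obj x),
      (∀ φ : RightComodule.homs (N.obj x) (P.obj x),
        RightComodule.ofHoms (RightContramodule.linMap g φ) =
          RightComodule.ofHoms φ ≫ TransComodule.app ψ x) ∧
      TransContramodule.app (G.map ψ) x =
        eqToHom (obj_eq P x) ≫ g ≫ eqToHom (obj_eq P' x).symm

end

/-! Over one cocommutative coalgebra `C` the statement is a form of the tensor-Hom adjunction. A
comodule morphism `M ⊠ N → P` is a bilinear map `B` such that each `B m` is colinear and `B (π f) n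
= B (f n₍₁₎) n₍₀₎`. The first condition says that `B` takes values in `Hom_C(N, P)`, the second that
`M → Hom_C(N, P)` respects the contraactions. This is the content of `contratensor.curry` and
`contratensor.uncurry`.

It remains to pass from one coalgebra to the representation. For `F`, the assignment `m ⊗ n ↦ M_α m
⊗ N_α n` respects the defining relation because `M_α` is a morphism into a contrarestriction and
`N_α` one into a corestriction: both sides reduce to `M_α (g n₍₁₎) ⊗ N_α n₍₀₎`
(`contratensor.mapAlong`).

For `G`, with `α : y → x`, the chain `Hom(N_y, W) ≅ Hom(α^! N_x, W) ≅ Hom(N_x, α^* W)` turns the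
cartesian condition into a universal property of `N_α`: every morphism `N_x → α^* W` is `h ∘ N_α`
for exactly one morphism `h : N_y → W` (`IsCartesian.map_comp_extend`, `IsCartesian.hom_ext`). The
structure map of `G` therefore sends `φ` to the unique `ψ` with `ψ ∘ N_α = P_α ∘ φ`, and no inverse
of `α^! N_x → N_y` has to be computed. Linearity, compatibility with contraactions, functoriality
and naturality are all tested on elements `N_α n`.

The same test yields the adjunction. For corresponding families `h` and `g`, compatibility with the
structure maps is on either side the single equation `P_α (h_x (m ⊗ n)) = h_y (M_α m ⊗ N_α n)`, so
the adjunctions at the objects assemble. -/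

namespace RightContramodule

variable {K : Type u} [Field K] {C : Type u} [AddCommGroup C] [Module K C] [Coalgebra K C]

theorem hom_ext {M N : RightContramodule K C} {f g : M ⟶ N} (h : ∀ m, linMap f m = linMap g m) :
    f = g :=
  Hom.ext (LinearMap.ext h)

theorem linMap_act {M N : RightContramodule K C} (f : M ⟶ N) (h : C →ₗ[K] M.carrier) :
    linMap f (M.act h) = N.act (linMap f ∘ₗ h) := Hom.comm f h

end RightContramodule

namespace RightComodule

variable {K : Type u} [Field K] {C D : Type u} [AddCommGroup C] [Module K C] [Coalgebra K C]
  [AddCommGroup D] [Module K D] [Coalgebra K D]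

/-- A morphism `f : M → α^* N` intertwines the coactions, after `α` is applied to that of `N`. -/
theorem lTensor_coact_linMap {α : C →ₗc[K] D} {M : RightComodule K D} {N : RightComodule K C}
    (f : M ⟶ (corestrict α).obj N) (m : M.carrier) :
    α.toLinearMap.lTensor N.carrier (N.coact (linMap f m)) =
      LinearMap.rTensor D (linMap f) (M.coact m) :=
  LinearMap.congr_fun (linMap_comm f) m

end RightComodule

/-! ### The contratensor-Hom adjunction over one coalgebra -/

section

variable {K : Type u} [Field K] {C D : Type u} [AddCommGroup C] [Module K C] [Coalgebra K C]
  [AddCommGroup D] [Module K D] [Coalgebra K D]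

open RightComodule

/-- The left coaction is unfolded to the flip of `N.coact n`, the form in which it also occurs in
`comHomActAux`. The relation of the contratensor product and the contraaction on `Hom_C(N, P)` can
then be compared without further rewriting. -/
theorem contratensorEval_tmul (M : RightContramodule K C) (N : RightComodule K C)
    (f : C →ₗ[K] M.carrier) (n : N.carrier) :
    contratensorEval M N (f ⊗ₜ n) =
      f.rTensor N.carrier (TensorProduct.comm K N.carrier C (N.coact n)) := by
  simp only [contratensorEval, leftCoact, LinearMap.comp_apply, LinearMap.lTensor_tmul,
    LinearEquiv.coe_coe]
  induction N.coact n using TensorProduct.induction_on with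
  | zero => simp
  | add a b ha hb => simp only [map_add, TensorProduct.tmul_add, ha, hb]
  | tmul a b => simp

namespace contratensor

variable [Coalgebra.IsCocomm K C]

/-- The projection `M ⊗ N → M ⊠_C N`. -/
def proj (M : RightContramodule K C) (N : RightComodule K C) :
    M.carrier ⊗[K] N.carrier →ₗ[K] (contratensor M N).carrier :=
  (contratensorRel M N).mkQ

/-- The map that sends `m` to `n ↦ m ⊗ n`, with values in `M ⊠_C N`. -/
def mk (M : RightContramodule K C) (N : RightComodule K C) :
    M.carrier →ₗ[K] N.carrier →ₗ[K] (contratensor M N).carrier :=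
  (TensorProduct.mk K M.carrier N.carrier).compr₂ (proj M N)

variable {M : RightContramodule K C} {N P : RightComodule K C}

theorem linearMap_ext {V : Type u} [AddCommGroup V] [Module K V]
    {f g : (contratensor M N).carrier →ₗ[K] V} (h : ∀ m n, f (tmul m n) = g (tmul m n)) :
    f = g :=
  Submodule.linearMap_qext _ (TensorProduct.ext' h)

theorem hom_ext {f g : contratensor M N ⟶ P}
    (h : ∀ m n, linMap f (tmul m n) = linMap g (tmul m n)) : f = g :=
  RightComodule.hom_ext (linearMap_ext h)

/-- The defining relation of the contratensor product. -/
theorem act_tmul (f : C →ₗ[K] M.carrier) (n : N.carrier) :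
    tmul (N := N) (M.act f) n =
      TensorProduct.lift (mk M N ∘ₗ f) (TensorProduct.comm K N.carrier C (N.coact n)) := by
  have h : proj M N (M.act f ⊗ₜ n) = proj M N (contratensorEval M N (f ⊗ₜ n)) := by
    -- The difference of the two representatives is the value at `f ⊗ n` of the map whose range is
    -- divided out.
    refine (Submodule.Quotient.eq _).2 ⟨f ⊗ₜ n, ?_⟩
    rw [LinearMap.sub_apply, LinearMap.rTensor_tmul]
  refine h.trans ?_
  rw [contratensorEval_tmul]
  have h2 : proj M N ∘ₗ f.rTensor N.carrier = TensorProduct.lift (mk M N ∘ₗ f) :=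
    TensorProduct.ext' fun _ _ => rfl
  exact LinearMap.congr_fun h2 _

/-- The coaction on the quotient is induced by that of `M ⊗ N`, which leaves the factor `m`
untouched; hence `m ⊗ -` is colinear. -/
theorem coact_tmul (m : M.carrier) (n : N.carrier) :
    (contratensor M N).coact (tmul m n) = (mk M N m).rTensor C (N.coact n) := by
  have h : (proj M N).rTensor C ∘ₗ (TensorProduct.assoc K M.carrier N.carrier C).symm.toLinearMap ∘ₗ
      TensorProduct.mk K M.carrier (N.carrier ⊗[K] C) m = (mk M N m).rTensor C :=
    TensorProduct.ext' fun _ _ => rfl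
  exact LinearMap.congr_fun h _

/-- For `m ∈ M`, the map `n ↦ m ⊗ n` is a morphism of comodules. -/
theorem mk_mem_homs (m : M.carrier) : mk M N m ∈ homs N (contratensor M N) :=
  LinearMap.ext fun n => coact_tmul m n

/-- The linear map `M ⊠_C N → P` that sends the class of `m ⊗ n` to `B m n`. -/
def liftLin {V : Type u} [AddCommGroup V] [Module K V]
    (B : M.carrier →ₗ[K] N.carrier →ₗ[K] V)
    (hact : ∀ (f : C →ₗ[K] M.carrier) (n : N.carrier), B (M.act f) n =
      TensorProduct.lift (B ∘ₗ f) (TensorProduct.comm K N.carrier C (N.coact n))) :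
    (contratensor M N).carrier →ₗ[K] V :=
  (contratensorRel M N).liftQ (TensorProduct.lift B) (by
    -- To descend, `B` must coequalize the two maps out of `Hom(C, M) ⊗ N`. On pure tensors this is
    -- `hact`.
    have h : TensorProduct.lift B ∘ₗ M.act.rTensor N.carrier =
        TensorProduct.lift B ∘ₗ contratensorEval M N := TensorProduct.ext' fun f n => by
      have h2 : TensorProduct.lift B ∘ₗ f.rTensor N.carrier = TensorProduct.lift (B ∘ₗ f) :=
        TensorProduct.ext' fun _ _ => rfl
      rw [LinearMap.comp_apply, LinearMap.comp_apply, contratensorEval_tmul,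
        LinearMap.rTensor_tmul, TensorProduct.lift.tmul, hact, ← h2, LinearMap.comp_apply]
    rintro _ ⟨t, rfl⟩
    rw [LinearMap.mem_ker, LinearMap.sub_apply, map_sub, sub_eq_zero]
    exact LinearMap.congr_fun h t)

/-- The morphism `M ⊠_C N → P` that sends the class of `m ⊗ n` to `B m n`. -/
def lift (B : M.carrier →ₗ[K] N.carrier →ₗ[K] P.carrier) (hB : ∀ m, B m ∈ homs N P)
    (hact : ∀ (f : C →ₗ[K] M.carrier) (n : N.carrier), B (M.act f) n =
      TensorProduct.lift (B ∘ₗ f) (TensorProduct.comm K N.carrier C (N.coact n))) :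
    contratensor M N ⟶ P :=
  Hom.mk (M := contratensor M N) (N := P) (liftLin B hact) (linearMap_ext fun m n => by
    have h : P.coact (B m n) = (B m).rTensor C (N.coact n) := LinearMap.congr_fun (hB m) n
    have h2 : (liftLin B hact).rTensor C ∘ₗ (mk M N m).rTensor C = (B m).rTensor C :=
      TensorProduct.ext' fun _ _ => rfl
    exact h.trans ((LinearMap.congr_fun h2 (N.coact n)).symm.trans
      (congrArg ((liftLin B hact).rTensor C) (coact_tmul m n).symm)))

/-- The linear map `M → Hom_C(N, P)` that corresponds to a morphism `M ⊠_C N → P`. -/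
def curryLin (h : contratensor M N ⟶ P) : M.carrier →ₗ[K] homs N P :=
  LinearMap.codRestrict (homs N P) ((mk M N).compr₂ (linMap h)) fun m =>
    (show Hom N P from ofHoms ⟨mk M N m, mk_mem_homs m⟩ ≫ h).mem

/-- The morphism of contramodules `M → Hom_C(N, P)` that corresponds to `M ⊠_C N → P`. -/
def curry (h : contratensor M N ⟶ P) : M ⟶ comHom N P :=
  RightContramodule.Hom.mk (M := M) (N := comHom N P) (curryLin h) fun f => by
    apply Subtype.ext
    ext n
    -- Applying `h` to the relation `act_tmul` gives the formula for the contraaction of `Hom_C(N,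
    -- P)`.
    have h2 : linMap h ∘ₗ TensorProduct.lift (mk M N ∘ₗ f) =
        TensorProduct.lift ((homs N P).subtype ∘ₗ curryLin h ∘ₗ f) :=
      TensorProduct.ext' fun _ _ => rfl
    exact (congrArg (linMap h) (act_tmul f n)).trans (LinearMap.congr_fun h2 _)

/-- The morphism `M ⊠_C N → P` that corresponds to a morphism `M → Hom_C(N, P)`. -/
def uncurry (g : M ⟶ comHom N P) : contratensor M N ⟶ P :=
  let g' : M.carrier →ₗ[K] homs N P := RightContramodule.linMap g
  lift ((homs N P).subtype ∘ₗ g') (fun m => (g' m).2) fun f n =>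
    -- Evaluated at `n`, compatibility of `g` with the contraactions is the balancing condition
    -- required by `lift`.
    congrArg (fun φ : homs N P => φ.1 n) (RightContramodule.linMap_act g f)

/-- The morphism `φ ⊠ f` for a morphism `φ : M → α_• M'` of contramodules and a morphism
`f : N → α^* N'` of comodules. -/
def mapAlong [Coalgebra.IsCocomm K D] (α : C →ₗc[K] D) {M : RightContramodule K D}
    {N : RightComodule K D} {M' : RightContramodule K C} {N' : RightComodule K C}
    (φ : M ⟶ (RightContramodule.contrarestrict α).obj M') (f : N ⟶ (corestrict α).obj N') :
    contratensor M N ⟶ (corestrict α).obj (contratensor M' N') :=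
  let φ' : M.carrier →ₗ[K] M'.carrier := RightContramodule.linMap φ
  let f' : N.carrier →ₗ[K] N'.carrier := linMap f
  let B : M.carrier →ₗ[K] N.carrier →ₗ[K] (contratensor M' N').carrier :=
    (mk M' N').compl₁₂ φ' f'
  lift (P := (corestrict α).obj (contratensor M' N')) B
    -- Colinearity of `B m` comes from writing it as `f` followed by the corestriction of `φ m ⊗ -`.
    (fun m => (show Hom N ((corestrict α).obj (contratensor M' N')) from
      f ≫ (corestrict α).map (ofHoms ⟨mk M' N' (φ' m), mk_mem_homs _⟩)).mem)
    fun g n => by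
      have h1 : φ' (M.act g) = M'.act (φ' ∘ₗ g ∘ₗ α.toLinearMap) :=
        RightContramodule.linMap_act φ g
      -- `Ψ` sends `n' ⊗ d` to the class of `φ (g d) ⊗ n'`. Since `g` is defined on `D` only, the
      -- relations over `C` and over `D` are compared in `N' ⊗ D`, where colinearity of `f`
      -- identifies the two arguments of `Ψ`.
      let Ψ : N'.carrier ⊗[K] D →ₗ[K] (contratensor M' N').carrier :=
        TensorProduct.lift (mk M' N' ∘ₗ φ' ∘ₗ g) ∘ₗ
          (TensorProduct.comm K N'.carrier D).toLinearMap
      have h2 : TensorProduct.lift (mk M' N' ∘ₗ φ' ∘ₗ g ∘ₗ α.toLinearMap) ∘ₗ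
          (TensorProduct.comm K N'.carrier C).toLinearMap =
            Ψ ∘ₗ α.toLinearMap.lTensor N'.carrier := TensorProduct.ext' fun _ _ => rfl
      have h3 : Ψ ∘ₗ f'.rTensor D =
          TensorProduct.lift (B ∘ₗ g) ∘ₗ (TensorProduct.comm K N.carrier D).toLinearMap :=
        TensorProduct.ext' fun _ _ => rfl
      calc tmul (φ' (M.act g)) (f' n)
          = tmul (M'.act (φ' ∘ₗ g ∘ₗ α.toLinearMap)) (f' n) := by rw [h1]
        _ = Ψ (α.toLinearMap.lTensor N'.carrier (N'.coact (f' n))) :=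
          (act_tmul _ _).trans (LinearMap.congr_fun h2 _)
        _ = Ψ (f'.rTensor D (N.coact n)) := congrArg Ψ (lTensor_coact_linMap f n)
        _ = _ := LinearMap.congr_fun h3 _

/-- The linear map `φ ⊠ f`. -/
def mapAlongLin [Coalgebra.IsCocomm K D] (α : C →ₗc[K] D) {M : RightContramodule K D}
    {N : RightComodule K D} {M' : RightContramodule K C} {N' : RightComodule K C}
    (φ : M ⟶ (RightContramodule.contrarestrict α).obj M') (f : N ⟶ (corestrict α).obj N') :
    (contratensor M N).carrier →ₗ[K] (contratensor M' N').carrier :=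
  linMap (mapAlong α φ f)

/-- The morphism `φ ⊠ id`. -/
def mapLeft {M' : RightContramodule K C} (φ : M ⟶ M') (N : RightComodule K C) :
    contratensor M N ⟶ contratensor M' N :=
  -- `curry` of the identity is the unit `m ↦ m ⊗ -` of the adjunction, so the composite is the
  -- transpose of `m ↦ φ m ⊗ -`.
  uncurry (φ ≫ curry (𝟙 (contratensor M' N)))

end contratensor

end

/-! ### Cartesian trans-comodules and the universal property of their structure maps -/

section

variable {K : Type u} [Field K] {X : Type w₁} [Category.{w₂} X] {𝒞 : X ⥤ CoalgCat.{u} K}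

open RightComodule

namespace TransComodule

theorem hom_ext {M N : TransComodule 𝒞} {f g : M ⟶ N} (h : ∀ x, app f x = app g x) : f = g :=
  Hom.ext (funext h)

theorem naturality_apply {M N : TransComodule 𝒞} (f : M ⟶ N) {x y : X} (α : x ⟶ y)
    (m : (M.obj y).carrier) :
    linMap (N.map α) (linMap (app f y) m) = linMap (app f x) (linMap (M.map α) m) :=
  congrArg (fun g => linMap g m) (Hom.naturality f α)

section

variable [IsQuasiFiniteRep 𝒞] {N : TransComodule 𝒞}

/-- `N.shriekMap α` is by definition the transpose of `N.map α`, and transposition is natural in the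
target. -/
theorem homEquiv_shriekMap_comp (N : TransComodule 𝒞) {y x : X} (α : y ⟶ x)
    {W : RightComodule K (𝒞.obj y)} (ψ : N.obj y ⟶ W) :
    (shriekAdj (𝒞.map α).toCoalgHom).homEquiv _ _ (N.shriekMap α ≫ ψ) =
      N.map α ≫ (corestrict (𝒞.map α).toCoalgHom).map ψ := by
  rw [Adjunction.homEquiv_naturality_right, shriekMap, Equiv.apply_symm_apply]

/-- Transposing both sides along `α^! ⊣ α^*` eliminates `α^!`. The formula prescribed for the
structure map of `G` thereby becomes a commutative square of the original structure maps, which can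
be checked on elements. -/
theorem shriekMap_comp_eq_iff {P : TransComodule 𝒞} {y x : X} (α : y ⟶ x)
    (ψ : N.obj y ⟶ P.obj y) (φ : N.obj x ⟶ P.obj x) :
    N.shriekMap α ≫ ψ = (shriek (𝒞.map α).toCoalgHom).map φ ≫ P.shriekMap α ↔
      N.map α ≫ (corestrict (𝒞.map α).toCoalgHom).map ψ = φ ≫ P.map α := by
  rw [← ((shriekAdj (𝒞.map α).toCoalgHom).homEquiv _ _).apply_eq_iff_eq,
    homEquiv_shriekMap_comp, Adjunction.homEquiv_naturality_left, shriekMap,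
    Equiv.apply_symm_apply]

/-- Over a cartesian `N`, the morphism `N_y → W` that corresponds to `N_x → α^* W`. -/
noncomputable def IsCartesian.extend (hN : N.IsCartesian) {y x : X} (α : y ⟶ x)
    {W : RightComodule K (𝒞.obj y)} (h : N.obj x ⟶ (corestrict (𝒞.map α).toCoalgHom).obj W) :
    N.obj y ⟶ W :=
  have := hN α
  inv (N.shriekMap α) ≫ ((shriekAdj (𝒞.map α).toCoalgHom).homEquiv _ _).symm h

/-- The existence half of the universal property of `N_α`: after transposition, the inverse in
`extend` cancels. -/
theorem IsCartesian.map_comp_extend (hN : N.IsCartesian) {y x : X} (α : y ⟶ x)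
    {W : RightComodule K (𝒞.obj y)} (h : N.obj x ⟶ (corestrict (𝒞.map α).toCoalgHom).obj W) :
    N.map α ≫ (corestrict (𝒞.map α).toCoalgHom).map (hN.extend α h) = h := by
  have := hN α
  rw [← homEquiv_shriekMap_comp, extend, IsIso.hom_inv_id_assoc, Equiv.apply_symm_apply]

theorem IsCartesian.extend_apply (hN : N.IsCartesian) {y x : X} (α : y ⟶ x)
    {W : RightComodule K (𝒞.obj y)} (h : N.obj x ⟶ (corestrict (𝒞.map α).toCoalgHom).obj W)
    (n : (N.obj x).carrier) : linMap (hN.extend α h) (linMap (N.map α) n) = linMap h n :=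
  congrArg (fun g => linMap g n) (hN.map_comp_extend α h)

/-- The uniqueness half. `N_α` need not be surjective; it nevertheless separates comodule morphisms
out of `N_y`, because `α^! N_x → N_y` is an isomorphism and transposition is injective. -/
theorem IsCartesian.hom_ext (hN : N.IsCartesian) {y x : X} (α : y ⟶ x)
    {W : RightComodule K (𝒞.obj y)} {f g : N.obj y ⟶ W}
    (h : ∀ n, linMap f (linMap (N.map α) n) = linMap g (linMap (N.map α) n)) : f = g := by
  have := hN α
  rw [← cancel_epi (N.shriekMap α),
    ← ((shriekAdj (𝒞.map α).toCoalgHom).homEquiv _ _).apply_eq_iff_eq,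
    homEquiv_shriekMap_comp, homEquiv_shriekMap_comp]
  exact RightComodule.hom_ext (LinearMap.ext h)

theorem IsCartesian.homs_ext (hN : N.IsCartesian) {y x : X} (α : y ⟶ x)
    {W : RightComodule K (𝒞.obj y)} {f g : homs (N.obj y) W}
    (h : ∀ n, f.1 (linMap (N.map α) n) = g.1 (linMap (N.map α) n)) : f = g :=
  Subtype.ext (congrArg linMap (hN.hom_ext α (f := ofHoms f) (g := ofHoms g) h))

/-- The linear map `Hom(N_x, P_x) → Hom(N_y, P_y)` that sends `φ` to the morphism `ψ` with
`ψ ∘ N_α = P_α ∘ φ`. -/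
noncomputable def IsCartesian.comHomMapLin (hN : N.IsCartesian) (P : TransComodule 𝒞) {y x : X} (α : y ⟶ x) :
    homs (N.obj x) (P.obj x) →ₗ[K] homs (N.obj y) (P.obj y) where
  toFun φ := ⟨linMap (hN.extend α (ofHoms φ ≫ P.map α)),
    (show RightComodule.Hom _ _ from hN.extend α (ofHoms φ ≫ P.map α)).mem⟩
  map_add' φ ψ := hN.homs_ext α fun n => by
    refine (hN.extend_apply α _ n).trans ((map_add (linMap (P.map α)) (φ.1 n) (ψ.1 n)).trans ?_)
    exact congrArg₂ (· + ·) (hN.extend_apply α (ofHoms φ ≫ P.map α) n).symm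
      (hN.extend_apply α (ofHoms ψ ≫ P.map α) n).symm
  map_smul' c φ := hN.homs_ext α fun n => by
    refine (hN.extend_apply α _ n).trans ((map_smul (linMap (P.map α)) c (φ.1 n)).trans ?_)
    exact congrArg (c • ·) (hN.extend_apply α (ofHoms φ ≫ P.map α) n).symm

theorem IsCartesian.comHomMapLin_apply (hN : N.IsCartesian) (P : TransComodule 𝒞) {y x : X} (α : y ⟶ x)
    (φ : homs (N.obj x) (P.obj x)) (n : (N.obj x).carrier) :
    (hN.comHomMapLin P α φ).1 (linMap (N.map α) n) = linMap (P.map α) (φ.1 n) :=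
  hN.extend_apply α (ofHoms φ ≫ P.map α) n

end

end TransComodule

namespace TransContramodule

theorem hom_ext {M N : TransContramodule 𝒞} {f g : M ⟶ N} (h : ∀ x, app f x = app g x) : f = g :=
  Hom.ext (funext h)

theorem naturality_apply {M N : TransContramodule 𝒞} (f : M ⟶ N) {x y : X} (α : x ⟶ y)
    (m : (M.obj y).carrier) :
    RightContramodule.linMap (N.map α) (RightContramodule.linMap (app f y) m) =
      RightContramodule.linMap (app f x) (RightContramodule.linMap (M.map α) m) :=
  congrArg (fun g => RightContramodule.linMap g m) (Hom.naturality f α)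

end TransContramodule

variable [∀ x, Coalgebra.IsCocomm K (𝒞.obj x)]

/-! ### The functor `F` -/

namespace TransContramodule

/-- The trans-comodule `(M_x ⊠ N_x)_x`. -/
def contratensor (M : TransContramodule 𝒞) (N : TransComodule 𝒞) : TransComodule 𝒞 where
  obj x := _root_.contratensor (M.obj x) (N.obj x)
  map α := contratensor.mapAlong _ (M.map α) (N.map α)
  map_id x t := by
    let f := contratensor.mapAlong _ (M.map (𝟙 x)) (N.map (𝟙 x))
    have h : contratensor.mapAlongLin _ (M.map (𝟙 x)) (N.map (𝟙 x)) = LinearMap.id :=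
      contratensor.linearMap_ext fun m n => congrArg₂
        (contratensor.tmul (M := M.obj x) (N := N.obj x)) (M.map_id x m) (N.map_id x n)
    exact LinearMap.congr_fun h t
  map_comp {x y z} α β t := by
    have h : contratensor.mapAlongLin _ (M.map (α ≫ β)) (N.map (α ≫ β)) =
        contratensor.mapAlongLin _ (M.map α) (N.map α) ∘ₗ
          contratensor.mapAlongLin _ (M.map β) (N.map β) :=
      contratensor.linearMap_ext fun m n => congrArg₂
        (contratensor.tmul (M := M.obj x) (N := N.obj x)) (M.map_comp α β m) (N.map_comp α β n)
    exact LinearMap.congr_fun h t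

/-- The functor `M ↦ (M_x ⊠ N_x)_x`. -/
def contratensorFunctor (N : TransComodule 𝒞) : TransContramodule 𝒞 ⥤ TransComodule 𝒞 where
  obj M := M.contratensor N
  map {M M'} φ := TransComodule.Hom.mk (M := M.contratensor N) (N := M'.contratensor N)
    (fun x => contratensor.mapLeft (app φ x) (N.obj x)) fun {x _} α =>
      contratensor.hom_ext fun m n =>
        congrArg (fun m => contratensor.tmul (M := M'.obj x) (N := N.obj x) m
          (linMap (N.map α) n)) (naturality_apply φ α m)
  map_id _ := TransComodule.hom_ext fun _ => contratensor.hom_ext fun _ _ => rfl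
  map_comp _ _ := TransComodule.hom_ext fun _ => contratensor.hom_ext fun _ _ => rfl

/-- The objects agree definitionally with the contratensor products, so every `eqToHom` is an
identity and the formulas hold by `rfl`. -/
theorem isContratensorFunctor (N : TransComodule 𝒞) :
    IsContratensorFunctor N (contratensorFunctor N) where
  obj_eq _ _ := rfl
  map_eq M _ _ α := ⟨contratensor.mapAlong _ (M.map α) (N.map α), fun _ _ => rfl, rfl⟩
  hom_eq φ x := ⟨contratensor.mapLeft (app φ x) (N.obj x), fun _ _ => rfl, rfl⟩

end TransContramodule

/-! ### The functor `G` and the adjunction -/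

namespace TransComodule.IsCartesian

variable [IsQuasiFiniteRep 𝒞] {N : TransComodule 𝒞}

/-- The structure morphism `Hom(N_x, P_x) → α_• Hom(N_y, P_y)`. -/
noncomputable def comHomMap (hN : N.IsCartesian) (P : TransComodule 𝒞) {y x : X} (α : y ⟶ x) :
    comHom (N.obj x) (P.obj x) ⟶
      (RightContramodule.contrarestrict (𝒞.map α).toCoalgHom).obj (comHom (N.obj y) (P.obj y)) :=
  RightContramodule.Hom.mk (M := comHom (N.obj x) (P.obj x))
    (N := RightContramodule.contrarestrictObj (𝒞.map α).toCoalgHom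
      (comHom (N.obj y) (P.obj y)))
    (hN.comHomMapLin P α) fun f => hN.homs_ext α fun n => by
      let a : 𝒞.obj y →ₗ[K] 𝒞.obj x := (𝒞.map α).toCoalgHom.toLinearMap
      let N' : (N.obj x).carrier →ₗ[K] (N.obj y).carrier := linMap (N.map α)
      let P' : (P.obj x).carrier →ₗ[K] (P.obj y).carrier := linMap (P.map α)
      let G := hN.comHomMapLin P α
      let f' : 𝒞.obj x →ₗ[K] homs (N.obj x) (P.obj x) := f
      -- `Ψ` sends `n ⊗ c` to `G (f c) n`. Tested on `N_α n`, both contraactions become `Ψ` of an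
      -- element of `N_y ⊗ 𝒞_x`, and colinearity of `N_α` says that the two elements agree.
      let Ψ : (N.obj y).carrier ⊗[K] 𝒞.obj x →ₗ[K] (P.obj y).carrier :=
        TensorProduct.lift ((homs (N.obj y) (P.obj y)).subtype ∘ₗ G ∘ₗ f') ∘ₗ
          (TensorProduct.comm K (N.obj y).carrier (𝒞.obj x)).toLinearMap
      have h1 : P' ∘ₗ TensorProduct.lift ((homs (N.obj x) (P.obj x)).subtype ∘ₗ f') ∘ₗ
          (TensorProduct.comm K (N.obj x).carrier (𝒞.obj x)).toLinearMap =
            Ψ ∘ₗ N'.rTensor (𝒞.obj x) := TensorProduct.ext' fun n c =>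
        (hN.comHomMapLin_apply P α (f' c) n).symm
      have h2 : TensorProduct.lift ((homs (N.obj y) (P.obj y)).subtype ∘ₗ G ∘ₗ f' ∘ₗ a) ∘ₗ
          (TensorProduct.comm K (N.obj y).carrier (𝒞.obj y)).toLinearMap =
            Ψ ∘ₗ a.lTensor (N.obj y).carrier := TensorProduct.ext' fun _ _ => rfl
      calc (G ((comHom (N.obj x) (P.obj x)).act f)).1 (N' n)
          = P' (comHomActAux (N.obj x) (P.obj x) f' n) := hN.comHomMapLin_apply P α _ n
        _ = Ψ (N'.rTensor (𝒞.obj x) ((N.obj x).coact n)) := LinearMap.congr_fun h1 _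
        _ = Ψ (a.lTensor (N.obj y).carrier ((N.obj y).coact (N' n))) :=
          congrArg Ψ (lTensor_coact_linMap (N.map α) n).symm
        _ = comHomActAux (N.obj y) (P.obj y) (G ∘ₗ f' ∘ₗ a) (N' n) :=
          (LinearMap.congr_fun h2 _).symm

/-- The trans-contramodule `(Hom(N_x, P_x))_x`. -/
noncomputable def comHom (hN : N.IsCartesian) (P : TransComodule 𝒞) : TransContramodule 𝒞 where
  obj x := _root_.comHom (N.obj x) (P.obj x)
  map α := hN.comHomMap P α
  map_id x φ :=
    let φ' : homs (N.obj x) (P.obj x) := φ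
    hN.homs_ext (𝟙 x) (g := φ') fun n =>
    (hN.comHomMapLin_apply P (𝟙 x) φ n).trans ((P.map_id x _).trans
      (congrArg φ'.1 (N.map_id x n).symm))
  map_comp {x y z} α β φ := hN.homs_ext (α ≫ β)
      (g := hN.comHomMapLin P α (hN.comHomMapLin P β φ)) fun n => by
    refine (hN.comHomMapLin_apply P (α ≫ β) φ n).trans ((P.map_comp α β _).trans ?_)
    -- The test element becomes `N_α (N_β n)`, on which the squares characterizing the structure
    -- maps at `α` and at `β` apply in turn.
    rw [N.map_comp α β n]
    exact (congrArg (linMap (P.map α)) (hN.comHomMapLin_apply P β φ n)).symm.trans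
      (hN.comHomMapLin_apply P α (hN.comHomMapLin P β φ) _).symm

end TransComodule.IsCartesian

/-- The morphism `φ ↦ ψ ∘ φ` of contramodules of morphisms. -/
def comHomMapRight {C : Type u} [AddCommGroup C] [Module K C] [Coalgebra K C]
    [Coalgebra.IsCocomm K C] (N : RightComodule K C) {P P' : RightComodule K C} (ψ : P ⟶ P') :
    comHom N P ⟶ comHom N P' :=
  -- `uncurry` of the identity is the evaluation `φ ⊗ n ↦ φ n`; composing with `ψ` and transposing
  -- back gives `φ ↦ ψ ∘ φ`, with compatibility with the contraactions already included.
  contratensor.curry (contratensor.uncurry (𝟙 (comHom N P)) ≫ ψ)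

namespace TransComodule.IsCartesian

variable [IsQuasiFiniteRep 𝒞] {N : TransComodule 𝒞}

/-- The functor `P ↦ (Hom(N_x, P_x))_x`. -/
noncomputable def comHomFunctor (hN : N.IsCartesian) :
    TransComodule 𝒞 ⥤ TransContramodule 𝒞 where
  obj P := hN.comHom P
  map {P P'} ψ := TransContramodule.Hom.mk (M := hN.comHom P) (N := hN.comHom P')
    (fun x => comHomMapRight (N.obj x) (app ψ x)) fun {x _} α =>
      RightContramodule.hom_ext fun φ => hN.homs_ext α fun n =>
        (hN.comHomMapLin_apply P' α _ n).trans ((naturality_apply ψ α _).trans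
          (congrArg (linMap (app ψ x)) (hN.comHomMapLin_apply P α φ n).symm))
  map_id _ := TransContramodule.hom_ext fun _ => rfl
  map_comp _ _ := TransContramodule.hom_ext fun _ => rfl

theorem isComHomFunctor (hN : N.IsCartesian) : IsComHomFunctor N hN.comHomFunctor where
  obj_eq _ _ := rfl
  map_eq P _ _ α := ⟨hN.comHomMap P α, fun φ =>
    -- The prescribed formula is the transpose of the square that defines `extend`.
    (shriekMap_comp_eq_iff α _ _).2 (hN.map_comp_extend α (ofHoms φ ≫ P.map α)), rfl⟩
  hom_eq ψ x := ⟨comHomMapRight (N.obj x) (app ψ x), fun _ => rfl, rfl⟩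

/-- The functor `M ↦ (M_x ⊠ N_x)_x` is left adjoint to `P ↦ (Hom(N_x, P_x))_x`. -/
noncomputable def contratensorAdj (hN : N.IsCartesian) :
    TransContramodule.contratensorFunctor N ⊣ hN.comHomFunctor :=
  Adjunction.mkOfHomEquiv
    { homEquiv := fun M P =>
        { toFun := fun h => TransContramodule.Hom.mk (M := M) (N := hN.comHom P)
            (fun x => contratensor.curry (app h x)) fun α =>
              -- On `N_α n`, the square for the transposed family is the naturality of `h` at the
              -- class of `m ⊗ n`.
              RightContramodule.hom_ext fun m => hN.homs_ext α fun n =>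
                (hN.comHomMapLin_apply P α _ n).trans
                  (naturality_apply h α (contratensor.tmul m n))
          invFun := fun g => TransComodule.Hom.mk (M := M.contratensor N) (N := P)
            (fun x => contratensor.uncurry (TransContramodule.app g x)) fun {x y} α =>
              contratensor.hom_ext fun m n =>
                -- Conversely, the naturality of `g` at `m` is evaluated at `N_α n`, where the
                -- structure map of `G` is known.
                (hN.comHomMapLin_apply P α (RightContramodule.linMap
                  (TransContramodule.app g y) m) n).symm.trans
                  (congrArg (fun φ : homs (N.obj x) (P.obj x) => φ.1 (linMap (N.map α) n))
                    (TransContramodule.naturality_apply g α m))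
          left_inv := fun _ => TransComodule.hom_ext fun _ => contratensor.hom_ext fun _ _ => rfl
          right_inv := fun _ => rfl }
      homEquiv_naturality_left_symm := fun _ _ =>
        TransComodule.hom_ext fun _ => contratensor.hom_ext fun _ _ => rfl
      homEquiv_naturality_right := fun _ _ => TransContramodule.hom_ext fun _ => rfl }

end TransComodule.IsCartesian

end

theorem mainTheorem12 {K : Type u} [Field K] {X : Type w₁} [Category.{w₂} X]
    (𝒞 : X ⥤ CoalgCat.{u} K) [∀ x, Coalgebra.IsCocomm K (𝒞.obj x)] (N : TransComodule 𝒞) :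
    ∃ F : TransContramodule 𝒞 ⥤ TransComodule 𝒞, IsContratensorFunctor N F ∧
      ∀ [IsQuasiFiniteRep 𝒞], N.IsCartesian →
        ∃ G : TransComodule 𝒞 ⥤ TransContramodule 𝒞, IsComHomFunctor N G ∧ Nonempty (F ⊣ G) :=
  ⟨TransContramodule.contratensorFunctor N, TransContramodule.isContratensorFunctor N,
    fun hN => ⟨hN.comHomFunctor, hN.isComHomFunctor, ⟨hN.contratensorAdj⟩⟩⟩
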